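/- A lattice $\Lambda\subset\mathbb Z^2$ means a subgroup of finite index; $\det\Lambda=[\mathbb Z^2:\Lambda]$ is its determinant and $\Lambda_d=\Lambda\cap d\mathbb Z^2$ for $d\ge 1$. A point $(u,v)\in\mathbb Z^2$ is primitive if $\gcd(u,v)=1$. Put $$\Theta(\Lambda)=\sum_{d\ge 1}\frac{\mu(d)}{\det(\Lambda_d)},\qquad \Psi_1(n)=\prod_{p\mid n}\Bigl(1+\frac1p\Bigr)^{-1},\qquad U(\alpha,\varepsilon)=\bigl(2^{21}\cdot 162\,\alpha^2\varepsilon^2\bigr)^{-2/5}.$$ (i) If $\Lambda$ contains a primitive point, then the series defining $\Theta(\Lambda)$ converges absolutely and $$\Theta(\Lambda)=\frac{6}{\pi^2}\,\frac{\Psi_1(\det\Lambda)}{\det\Lambda}.$$ (ii) For all real $\varepsilon_0,\alpha_0$ there is a constant $C>0$, depending only on $\varepsilon_0$ and $\alpha_0$, with the following property. Let $\tfrac12<r<\tfrac7{10}$, $0<\varepsilon\le\varepsilon_0$, $K>0$, $B\ge 2$ be real, let $1\le a<b$ be integers such that $\alpha=\sqrt{b/a}$ is irrational and $\alpha\le\alpha_0$,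 and let $\Lambda$ be a lattice containing a primitive point. Assume $$K^2 b\le U(\alpha,\varepsilon)\,B^{\frac45\left(\frac1r-1\right)-\frac35\left(2-\frac1r\right)},\qquad b\,(\det\Lambda)^2\le K^2B^{2-\frac1r}.$$ Then the set $$S=\Bigl\{(u,v)\in\Lambda:\ u\ge 0,\ v>0,\ \gcd(u,v)=1,\ 0<\frac uv-\alpha\le\varepsilon B^{-1/r},\ v\le KB\Bigr\}$$ is finite and $$\Bigl|\#S-\frac{\Theta(\Lambda)\,\varepsilon K^2}{2}B^{2-\frac1r}\Bigr|\le C\Bigl(K^{\frac32}b^{\frac14}(\det\Lambda)^{\frac12}B^{\frac34\left(2-\frac1r\right)}\log B+K\,b^{\frac32}B^{1-\frac1{2r}}\log B\Bigr).$$ -/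

import Mathlib

namespace ZoomLattice

/-- A point `(u, v)` of `ℤ²` is primitive when its coordinates are coprime. -/
def IsPrimitive (p : ℤ × ℤ) : Prop := Int.gcd p.1 p.2 = 1

/-- The determinant of a (full rank) lattice `Λ ⊆ ℤ²`: its covolume, that is, its index in `ℤ²`. -/
noncomputable def latticeDet (Λ : AddSubgroup (ℤ × ℤ)) : ℕ := Λ.index

/-- The sublattice `Λ_d = Λ ∩ dℤ²`. -/
def sublattice (Λ : AddSubgroup (ℤ × ℤ)) (d : ℕ) : AddSubgroup (ℤ × ℤ) :=
  Λ ⊓ (nsmulAddMonoidHom d : ℤ × ℤ →+ ℤ × ℤ).range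

/-- The general term `μ(d) / det(Λ_d)` of the series defining `Θ(Λ)` (it is `0` for `d = 0`). -/
noncomputable def thetaTerm (Λ : AddSubgroup (ℤ × ℤ)) (d : ℕ) : ℝ :=
  (ArithmeticFunction.moebius d : ℝ) / (latticeDet (sublattice Λ d) : ℝ)

/-- `Θ(Λ) = ∑_{d ≥ 1} μ(d) / det(Λ_d)`. -/
noncomputable def Theta (Λ : AddSubgroup (ℤ × ℤ)) : ℝ := ∑' d : ℕ, thetaTerm Λ d

/-- `Ψ₁(n) = ∏_{p ∣ n} (1 + 1/p)⁻¹`, the product being over the primes dividing `n`. -/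
noncomputable def Psi1 (n : ℕ) : ℝ := ∏ p ∈ n.primeFactors, (1 + 1 / (p : ℝ))⁻¹

/-- The primitive points `(u, v)` of `Λ` with nonnegative coordinates (and `v > 0`, so that `u / v`
makes sense) such that `0 < u / v - α ≤ ε B^{-1/r}` and `v ≤ K B`. -/
def zoomSet (α r ε K B : ℝ) (Λ : AddSubgroup (ℤ × ℤ)) : Set (ℤ × ℤ) :=
  {p | p ∈ Λ ∧ IsPrimitive p ∧ 0 ≤ p.1 ∧ 0 < p.2 ∧
    0 < (p.1 : ℝ) / (p.2 : ℝ) - α ∧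
    (p.1 : ℝ) / (p.2 : ℝ) - α ≤ ε * B ^ (-(1 / r)) ∧
    (p.2 : ℝ) ≤ K * B}

/-- `U(α, ε) = (2²¹ · 162 α² ε²)^{-2/5}`. -/
noncomputable def sizeConst (α ε : ℝ) : ℝ :=
  (2 ^ 21 * 162 * α ^ 2 * ε ^ 2 : ℝ) ^ (-(2 / 5) : ℝ)

end ZoomLattice

/-! Part (i). Let `w₀ ∈ Λ` be primitive and `n` the index of `Λ`. The kernel of `w ↦ det (w₀, w)` is
`ℤ w₀ ⊆ Λ`, so `Λ` is the preimage of a subgroup of `ℤ`, namely `nℤ` (`eq_cyclicLattice`). Hence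
`Λ_d` is `d` times a lattice of the same kind with modulus `n / gcd(n, d)`, its determinant is `d² n
/ gcd(n, d)`, and `Θ(Λ)` is `1/n` times an Euler product.

Part (ii). With `δ = ε B^(-1/r)` and `V = K B`, the set consists of the primitive points of `Λ` in
the triangle `0 < u - αv ≤ δv`, `v ≤ V`. Since `α² = b/a` and `α` is irrational, `a u² - b v²` is a
nonzero integer at nonzero integer points, so `a |u - αv| |u + αv| ≥ 1` (`one_le_norm_form`). Put `D
= V √(δ a (δ + 2α))`. The inequality empties the triangle when `D < 1` (`notMem_thinTriangle`). It
also bounds below the first vector of a reduced basis, so that every lattice of determinant `m`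
containing a primitive point has `δV²/(2m)` points in the triangle up to `5D + 3`, uniformly in `m`
(`thinTriangle_count`).

Möbius inversion replaces `V` by `V/d`, hence `D` by `D/d`. The `d ≤ D` cost a harmonic sum; for `d
> D` no points remain, only the tail of the series for `Θ`. The total error is `O(D (1 + log⁺ D))`
(`primitive_thinTriangle_count`). Finally `D² ≪ K² b B^(2 - 1/r)`, so `D` is controlled by the
second error term alone, and the size hypothesis gives `D² ≪ B`, so `log D ≪ log B`. -/

namespace ZoomLattice

/-! ### Lattices containing a primitive point, and the determinants of `Λ_d` -/

/-- The linear form `w ↦ det (w₀, w)` on `ℤ²`. -/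
def detForm (w₀ : ℤ × ℤ) : ℤ × ℤ →+ ℤ where
  toFun w := w₀.1 * w.2 - w₀.2 * w.1
  map_zero' := by simp
  map_add' x y := by simp only [Prod.fst_add, Prod.snd_add]; ring

lemma detForm_apply (w₀ w : ℤ × ℤ) : detForm w₀ w = w₀.1 * w.2 - w₀.2 * w.1 := rfl

lemma IsPrimitive.exists_bezout {w₀ : ℤ × ℤ} (h : IsPrimitive w₀) :
    ∃ w₁ : ℤ × ℤ, w₀.1 * w₁.2 - w₀.2 * w₁.1 = 1 := by
  obtain ⟨a, b, hab⟩ := Int.isCoprime_iff_gcd_eq_one.mpr h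
  exact ⟨(-b, a), by simp only; linarith⟩

lemma detForm_surjective {w₀ : ℤ × ℤ} (h : IsPrimitive w₀) :
    Function.Surjective (detForm w₀) := by
  obtain ⟨w₁, hw₁⟩ := h.exists_bezout
  intro k
  refine ⟨k • w₁, ?_⟩
  rw [map_zsmul, detForm_apply, hw₁, smul_eq_mul, mul_one]

/-- The lattice of all `w` with `m ∣ det (w₀, w)`. -/
def cyclicLattice (w₀ : ℤ × ℤ) (m : ℕ) : AddSubgroup (ℤ × ℤ) :=
  (AddSubgroup.zmultiples (m : ℤ)).comap (detForm w₀)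

lemma mem_cyclicLattice {w₀ w : ℤ × ℤ} {m : ℕ} :
    w ∈ cyclicLattice w₀ m ↔ (m : ℤ) ∣ w₀.1 * w.2 - w₀.2 * w.1 := by
  rw [cyclicLattice, AddSubgroup.mem_comap, Int.mem_zmultiples_iff, detForm_apply]

lemma index_cyclicLattice {w₀ : ℤ × ℤ} (h : IsPrimitive w₀) (m : ℕ) :
    (cyclicLattice w₀ m).index = m := by
  rw [cyclicLattice, AddSubgroup.index_comap_of_surjective _ (detForm_surjective h),
    Int.index_zmultiples, Int.natAbs_natCast]

/-- A lattice containing a primitive point `w₀` is cut out by one congruence. -/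
lemma eq_cyclicLattice {Λ : AddSubgroup (ℤ × ℤ)} {w₀ : ℤ × ℤ} (h : IsPrimitive w₀)
    (hw₀ : w₀ ∈ Λ) : Λ = cyclicLattice w₀ Λ.index := by
  -- Completing `w₀` to a basis by a Bézout vector shows that the kernel is spanned by `w₀`.
  have hker : (detForm w₀).ker ≤ Λ := by
    intro w hw
    rw [AddMonoidHom.mem_ker, detForm_apply] at hw
    obtain ⟨w₁, hw₁⟩ := h.exists_bezout
    have : w = (w.1 * w₁.2 - w.2 * w₁.1) • w₀ := by
      ext
      · simp only [Prod.smul_fst, smul_eq_mul]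
        linear_combination (-w.1) * hw₁ + w₁.1 * hw
      · simp only [Prod.smul_snd, smul_eq_mul]
        linear_combination (-w.2) * hw₁ + w₁.2 * hw
    rw [this]
    exact Λ.zsmul_mem hw₀ _
  have hmap : Λ = (Λ.map (detForm w₀)).comap (detForm w₀) := by
    rw [AddSubgroup.comap_map_eq, sup_eq_left.mpr hker]
  have hidx : (Λ.map (detForm w₀)).index = Λ.index :=
    AddSubgroup.index_map_eq _ (detForm_surjective h) hker
  obtain ⟨k, hk⟩ := Int.subgroup_cyclic (Λ.map (detForm w₀))
  rw [← AddSubgroup.zmultiples_eq_closure] at hk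
  rw [hk, Int.index_zmultiples] at hidx
  have habs : AddSubgroup.zmultiples |k| = AddSubgroup.zmultiples k := by
    ext z
    rw [Int.mem_zmultiples_iff, Int.mem_zmultiples_iff, abs_dvd]
  rw [← hidx, cyclicLattice, Int.natCast_natAbs, habs, ← hk, ← hmap]

lemma natCast_dvd_mul_iff {n d : ℕ} (hn : 0 < n) (z : ℤ) :
    (n : ℤ) ∣ d * z ↔ ((n / n.gcd d : ℕ) : ℤ) ∣ z := by
  have hg : 0 < n.gcd d := Nat.gcd_pos_of_pos_left d hn
  have hco : (n / n.gcd d).Coprime (d / n.gcd d) := Nat.coprime_div_gcd_div_gcd hg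
  have hn' : (n : ℤ) = (n.gcd d : ℕ) * ((n / n.gcd d : ℕ) : ℤ) := by
    exact_mod_cast (Nat.mul_div_cancel' (Nat.gcd_dvd_left n d)).symm
  have hd' : (d : ℤ) = (n.gcd d : ℕ) * ((d / n.gcd d : ℕ) : ℤ) := by
    exact_mod_cast (Nat.mul_div_cancel' (Nat.gcd_dvd_right n d)).symm
  have hg0 : ((n.gcd d : ℕ) : ℤ) ≠ 0 := by exact_mod_cast hg.ne'
  calc (n : ℤ) ∣ d * z
      ↔ ((n.gcd d : ℕ) : ℤ) * ((n / n.gcd d : ℕ) : ℤ) ∣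
          (n.gcd d : ℕ) * (((d / n.gcd d : ℕ) : ℤ) * z) := by rw [← hn', ← mul_assoc, ← hd']
    _ ↔ ((n / n.gcd d : ℕ) : ℤ) ∣ ((d / n.gcd d : ℕ) : ℤ) * z := mul_dvd_mul_iff_left hg0
    _ ↔ _ := 
      ⟨(Nat.isCoprime_iff_coprime.mpr hco).dvd_of_dvd_mul_left, (dvd_mul_of_dvd_right · _)⟩

lemma comap_nsmul_cyclicLattice {w₀ : ℤ × ℤ} {n : ℕ} (hn : 0 < n) (d : ℕ) :
    (cyclicLattice w₀ n).comap (nsmulAddMonoidHom d : ℤ × ℤ →+ ℤ × ℤ) =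
      cyclicLattice w₀ (n / n.gcd d) := by
  ext w
  rw [AddSubgroup.mem_comap, mem_cyclicLattice, mem_cyclicLattice, ← natCast_dvd_mul_iff hn]
  rw [nsmulAddMonoidHom_apply, Prod.smul_fst, Prod.smul_snd, nsmul_eq_mul, nsmul_eq_mul, mul_sub,
    mul_left_comm w₀.1, mul_left_comm w₀.2]

lemma index_range_nsmul (d : ℕ) :
    (nsmulAddMonoidHom d : ℤ × ℤ →+ ℤ × ℤ).range.index = d ^ 2 := by
  have : (nsmulAddMonoidHom d : ℤ × ℤ →+ ℤ × ℤ).range =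
      (AddSubgroup.zmultiples (d : ℤ)).prod (AddSubgroup.zmultiples (d : ℤ)) := by
    ext ⟨x, y⟩
    rw [AddMonoidHom.mem_range, AddSubgroup.mem_prod, Int.mem_zmultiples_iff,
      Int.mem_zmultiples_iff]
    constructor
    · rintro ⟨⟨a, b⟩, h⟩
      simp only [nsmulAddMonoidHom_apply, Prod.smul_mk, Prod.mk.injEq, nsmul_eq_mul] at h
      exact ⟨⟨a, h.1.symm⟩, ⟨b, h.2.symm⟩⟩
    · rintro ⟨⟨a, ha⟩, ⟨b, hb⟩⟩
      refine ⟨(a, b), ?_⟩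
      simp only [nsmulAddMonoidHom_apply, Prod.smul_mk, Prod.mk.injEq, nsmul_eq_mul]
      exact ⟨ha.symm, hb.symm⟩
  rw [this, AddSubgroup.index_prod, Int.index_zmultiples, Int.natAbs_natCast, sq]

/-- The index of `Λ ∩ dℤ²` factors through `dℤ²`, and multiplication by `d` identifies the relative
index with the index of `{w | d w ∈ Λ}`, again a cyclic lattice. For `d = 0` both sides are `0`. -/
lemma latticeDet_sublattice {Λ : AddSubgroup (ℤ × ℤ)} (hΛ : Λ.FiniteIndex)
    (h : ∃ p ∈ Λ, IsPrimitive p) (d : ℕ) :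
    latticeDet (sublattice Λ d) = d ^ 2 * (latticeDet Λ / (latticeDet Λ).gcd d) := by
  obtain ⟨w₀, hw₀, hp⟩ := h
  have hn : 0 < Λ.index := Nat.pos_of_ne_zero hΛ.index_ne_zero
  rw [latticeDet, latticeDet, sublattice, ← AddSubgroup.relIndex_mul_index inf_le_right,
    AddSubgroup.inf_relIndex_right, ← AddSubgroup.index_comap, index_range_nsmul]
  nth_rewrite 1 [eq_cyclicLattice hp hw₀]
  rw [comap_nsmul_cyclicLattice hn, index_cyclicLattice hp, mul_comm]

/-! ### The Euler product for `Θ` -/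

/-- The multiplicative function `μ(d) gcd(n, d) / d²`. -/
noncomputable def moebiusGcd (n d : ℕ) : ℝ :=
  (ArithmeticFunction.moebius d : ℝ) * (n.gcd d : ℝ) / (d : ℝ) ^ 2

lemma thetaTerm_eq {Λ : AddSubgroup (ℤ × ℤ)} (hΛ : Λ.FiniteIndex)
    (h : ∃ p ∈ Λ, IsPrimitive p) (d : ℕ) :
    thetaTerm Λ d = moebiusGcd (latticeDet Λ) d / latticeDet Λ := by
  have hn : 0 < latticeDet Λ := Nat.pos_of_ne_zero hΛ.index_ne_zero
  have hg : 0 < (latticeDet Λ).gcd d := Nat.gcd_pos_of_pos_left d hn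
  rw [thetaTerm, latticeDet_sublattice hΛ h, moebiusGcd, Nat.cast_mul,
    Nat.cast_div (Nat.gcd_dvd_left _ _) (by positivity)]
  push_cast
  field_simp

lemma norm_moebiusGcd_le {n : ℕ} (hn : 0 < n) (d : ℕ) :
    ‖moebiusGcd n d‖ ≤ n * (1 / (d : ℝ) ^ 2) := by
  have h1 : |(ArithmeticFunction.moebius d : ℝ)| ≤ 1 := by
    exact_mod_cast ArithmeticFunction.abs_moebius_le_one (n := d)
  have h2 : (n.gcd d : ℝ) ≤ n := by exact_mod_cast Nat.gcd_le_left d hn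
  rw [moebiusGcd, Real.norm_eq_abs, abs_div, abs_mul, Nat.abs_cast (n.gcd d),
    abs_of_nonneg (sq_nonneg (d : ℝ)), ← mul_one_div]
  gcongr
  calc _ ≤ 1 * (n : ℝ) := by gcongr
    _ = n := one_mul _

lemma summable_norm_moebiusGcd {n : ℕ} (hn : 0 < n) : Summable (‖moebiusGcd n ·‖) :=
  Summable.of_nonneg_of_le (fun _ ↦ norm_nonneg _) (norm_moebiusGcd_le hn)
    (hasSum_zeta_two.summable.mul_left _)

lemma moebiusGcd_mul (n : ℕ) {d e : ℕ} (h : d.Coprime e) :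
    moebiusGcd n (d * e) = moebiusGcd n d * moebiusGcd n e := by
  rw [moebiusGcd, moebiusGcd, moebiusGcd,
    ArithmeticFunction.isMultiplicative_moebius.map_mul_of_coprime h, h.gcd_mul n]
  push_cast
  ring

/-- Only `e = 0, 1` contribute, giving `1 - gcd(n, p)/p²`. When `p ∣ n` this is `1 - 1/p = (1 -
1/p²)(1 + 1/p)⁻¹`, so the factors of `1/ζ(2)` and of `Psi1` separate. -/
lemma tsum_moebiusGcd_prime_pow (n : ℕ) {p : ℕ} (hp : p.Prime) :
    ∑' e, moebiusGcd n (p ^ e) =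
      (1 - ((p : ℝ) ^ 2)⁻¹) * if p ∣ n then (1 + 1 / (p : ℝ))⁻¹ else 1 := by
  have hp0 : (0 : ℝ) < p := by exact_mod_cast hp.pos
  rw [tsum_eq_sum (s := Finset.range 2)]
  · rw [Finset.sum_range_succ, Finset.sum_range_one, pow_zero, pow_one]
    simp only [moebiusGcd, ArithmeticFunction.moebius_apply_prime hp]
    split_ifs with h
    · rw [Nat.gcd_eq_right h]
      simp
      field_simp
      ring
    · rw [(hp.coprime_iff_not_dvd.mpr h).symm]
      simp
      ring
  · intro e he
    have he2 : ¬ e < 2 := by rwa [← Finset.mem_range]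
    rw [moebiusGcd, ArithmeticFunction.moebius_apply_prime_pow hp (by omega), if_neg (by omega)]
    simp

lemma hasProd_one_sub_inv_prime_sq :
    HasProd (fun p : Nat.Primes ↦ 1 - (((p : ℕ) : ℝ) ^ 2)⁻¹) (6 / Real.pi ^ 2) := by
  let f : ℕ →*₀ ℝ :=
    { toFun := fun n ↦ ((n : ℝ) ^ 2)⁻¹
      map_zero' := by simp
      map_one' := by simp
      map_mul' := fun x y ↦ by push_cast; rw [mul_pow, mul_inv] }
  have hf : ∀ n, f n = 1 / (n : ℝ) ^ 2 := fun n ↦ (one_div _).symm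
  have hs : HasSum (fun n ↦ f n) (Real.pi ^ 2 / 6) := by
    simp only [hf]; exact hasSum_zeta_two
  have h := EulerProduct.eulerProduct_completely_multiplicative_hasProd hs.summable.norm
  rw [hs.tsum_eq] at h
  have h2 := (Filter.Tendsto.inv₀ h (by positivity))
  rw [inv_div] at h2
  refine h2.congr fun s ↦ ?_
  rw [← Finset.prod_inv_distrib]
  simp only [inv_inv]
  rfl

lemma hasProd_Psi1 {n : ℕ} (hn : n ≠ 0) :
    HasProd (fun p : Nat.Primes ↦ if (p : ℕ) ∣ n then (1 + 1 / ((p : ℕ) : ℝ))⁻¹ else 1)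
      (Psi1 n) := by
  have : Psi1 n = ∏ p ∈ n.primeFactors.subtype Nat.Prime,
      if (p : ℕ) ∣ n then (1 + 1 / ((p : ℕ) : ℝ))⁻¹ else 1 := by
    rw [Finset.prod_subtype_of_mem (fun p : ℕ ↦ if p ∣ n then (1 + 1 / (p : ℝ))⁻¹ else 1)
      fun p hp ↦ Nat.prime_of_mem_primeFactors hp, Psi1]
    exact Finset.prod_congr rfl fun p hp ↦ (if_pos (Nat.dvd_of_mem_primeFactors hp)).symm
  rw [this]
  refine hasProd_prod_of_ne_finset_one fun p hp ↦ if_neg fun hd ↦ hp ?_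
  refine Finset.mem_subtype.mpr ?_
  exact Nat.mem_primeFactors.mpr ⟨p.2, hd, hn⟩

lemma tsum_moebiusGcd {n : ℕ} (hn : 0 < n) :
    ∑' d, moebiusGcd n d = 6 / Real.pi ^ 2 * Psi1 n := by
  have h := EulerProduct.eulerProduct_hasProd (f := moebiusGcd n) (by simp [moebiusGcd])
    (fun {d e} h ↦ moebiusGcd_mul n h) (summable_norm_moebiusGcd hn) (by simp [moebiusGcd])
  have h2 := hasProd_one_sub_inv_prime_sq.mul (hasProd_Psi1 hn.ne')
  refine h.unique (h2.congr_fun ?_)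
  intro p
  exact tsum_moebiusGcd_prime_pow n p.2

lemma summable_thetaTerm {Λ : AddSubgroup (ℤ × ℤ)} (hΛ : Λ.FiniteIndex)
    (h : ∃ p ∈ Λ, IsPrimitive p) : Summable (thetaTerm Λ) := by
  have hn : 0 < latticeDet Λ := Nat.pos_of_ne_zero hΛ.index_ne_zero
  simp only [funext (thetaTerm_eq hΛ h)]
  exact (summable_norm_moebiusGcd hn).of_norm.div_const _

lemma Theta_eq {Λ : AddSubgroup (ℤ × ℤ)} (hΛ : Λ.FiniteIndex)
    (h : ∃ p ∈ Λ, IsPrimitive p) :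
    Theta Λ = 6 / Real.pi ^ 2 * Psi1 (latticeDet Λ) / (latticeDet Λ : ℝ) := by
  have hn : 0 < latticeDet Λ := Nat.pos_of_ne_zero hΛ.index_ne_zero
  rw [Theta, funext (thetaTerm_eq hΛ h), tsum_div_const, tsum_moebiusGcd hn]

/-! ### Integer points in a triangle, counted row by row -/

lemma abs_card_Icc_sub_le {L U : ℝ} (h : L ≤ U) {s : Finset ℤ}
    (h1 : ∀ i ∈ s, L ≤ i ∧ (i : ℝ) ≤ U) (h2 : ∀ i : ℤ, L < i → (i : ℝ) < U → i ∈ s) :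
    |(s.card : ℝ) - (U - L)| ≤ 1 := by
  have hup : (s.card : ℤ) ≤ ⌊U⌋ + 1 - ⌈L⌉ ∨ (s.card : ℤ) ≤ 0 := by
    have : s.card ≤ (Finset.Icc ⌈L⌉ ⌊U⌋).card := Finset.card_le_card fun i hi ↦
      Finset.mem_Icc.mpr ⟨Int.ceil_le.mpr (h1 i hi).1, Int.le_floor.mpr (h1 i hi).2⟩
    rw [Int.card_Icc] at this
    omega
  have hlow : ⌈U⌉ - 1 - ⌊L⌋ ≤ (s.card : ℤ) := by
    have : (Finset.Ioo ⌊L⌋ ⌈U⌉).card ≤ s.card := Finset.card_le_card fun i hi ↦ by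
      rw [Finset.mem_Ioo] at hi
      exact h2 i (Int.floor_lt.mp hi.1) (Int.lt_ceil.mp hi.2)
    rw [Int.card_Ioo] at this
    omega
  have a1 := Int.floor_le U
  have a2 := Int.le_ceil L
  have a3 := Int.le_ceil U
  have a4 := Int.floor_le L
  have hlow' : ((⌈U⌉ : ℝ) - 1 - ⌊L⌋) ≤ s.card := by exact_mod_cast hlow
  rw [abs_le]
  constructor
  · linarith
  · rcases hup with hup | hup
    · have : (s.card : ℝ) ≤ (⌊U⌋ : ℝ) + 1 - ⌈L⌉ := by exact_mod_cast hup
      linarith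
    · have : (s.card : ℝ) ≤ 0 := by exact_mod_cast hup
      linarith

lemma sum_range_add_natCast (θ : ℝ) (k : ℕ) :
    ∑ t ∈ Finset.range k, (θ + t) = k * θ + k * (k - 1) / 2 := by
  induction k with
  | zero => simp
  | succ k ih => rw [Finset.sum_range_succ, ih]; push_cast; ring

/-- Riemann sum of a linear function decreasing from `M` at `y₀` to `0` at `y₀ + h`. -/
lemma abs_sum_linear_sub_le {y₀ h M : ℝ} (hh : 0 < h) (hM : 0 ≤ M) :
    |∑ j ∈ Finset.Ioc ⌊y₀⌋ ⌊y₀ + h⌋, M * (1 - ((j : ℝ) - y₀) / h) - M * h / 2| ≤ M := by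
  obtain ⟨k, hk⟩ : ∃ k : ℕ, ⌊y₀ + h⌋ = ⌊y₀⌋ + k :=
    ⟨(⌊y₀ + h⌋ - ⌊y₀⌋).toNat, by
      have : ⌊y₀⌋ ≤ ⌊y₀ + h⌋ := Int.floor_le_floor (by linarith)
      omega⟩
  have hkR : (⌊y₀ + h⌋ : ℝ) = ⌊y₀⌋ + k := by rw [hk]; push_cast; rfl
  have f1 := Int.floor_le (y₀ + h)
  have f2 := Int.lt_floor_add_one (y₀ + h)
  have f3 := Int.floor_le y₀
  have f4 := Int.lt_floor_add_one y₀
  obtain ⟨θ, hθ⟩ : ∃ θ : ℝ, θ = ⌊y₀⌋ + 1 - y₀ := ⟨_, rfl⟩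
  have hset : Finset.Ioc ⌊y₀⌋ ⌊y₀ + h⌋ =
      (Finset.range k).image (fun t : ℕ ↦ ⌊y₀⌋ + 1 + (t : ℤ)) := by
    ext j
    rw [hk, Finset.mem_Ioc, Finset.mem_image]
    constructor
    · rintro ⟨h1, h2⟩
      exact ⟨(j - ⌊y₀⌋ - 1).toNat, Finset.mem_range.mpr (by omega), by omega⟩
    · rintro ⟨t, ht, rfl⟩
      rw [Finset.mem_range] at ht
      omega
  have hsum : ∑ j ∈ Finset.Ioc ⌊y₀⌋ ⌊y₀ + h⌋, M * (1 - ((j : ℝ) - y₀) / h) =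
      M * (k - (k * θ + k * (k - 1) / 2) / h) := by
    have ht : ∀ t : ℕ, ((⌊y₀⌋ + 1 + (t : ℤ) : ℤ) : ℝ) - y₀ = θ + t := fun t ↦ by
      push_cast
      rw [hθ]
      ring
    rw [hset, Finset.sum_image (fun a _ b _ hab ↦ by simpa using hab), ← Finset.mul_sum,
      Finset.sum_sub_distrib, ← Finset.sum_div]
    simp only [ht, sum_range_add_natCast, Finset.sum_const, Finset.card_range, nsmul_eq_mul,
      mul_one]
  -- `θ` is the distance from `y₀` to the next integer strictly above it, and `ρ` below is the
  -- fractional part of `y₀ + h`. In these terms the error is an explicit quadratic expression.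
  have hkey : |(k : ℝ) - (k * θ + k * (k - 1) / 2) / h - h / 2| ≤ 1 := by
    have e : (k : ℝ) - (k * θ + k * (k - 1) / 2) / h - h / 2 =
        (k * h - (k * θ + k * (k - 1) / 2) - h ^ 2 / 2) / h := by field_simp
    rw [e, abs_div, abs_of_pos hh, div_le_one hh]
    obtain ⟨ρ, hρ⟩ : ∃ ρ : ℝ, h = θ + k - 1 + ρ := ⟨h - (θ + k - 1), by ring⟩
    have r0 : 0 ≤ ρ := by linarith
    have r1 : ρ ≤ 1 := by linarith
    have t0 : 0 ≤ θ := by linarith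
    have t1 : θ ≤ 1 := by linarith
    have hid : k * h - (k * θ + k * (k - 1) / 2) - h ^ 2 / 2 =
        (-ρ ^ 2 + (k - 1) + 2 * ρ - 2 * θ * (h - θ) - θ ^ 2) / 2 := by
      rw [hρ]; ring
    rw [hid, abs_le]
    rcases Nat.eq_zero_or_pos k with rfl | hk0
    · simp only [Nat.cast_zero] at *
      constructor <;> nlinarith
    · have hk1 : (1 : ℝ) ≤ k := by exact_mod_cast hk0
      have hht : 0 ≤ h - θ := by linarith
      constructor
      · nlinarith [mul_le_mul_of_nonneg_right t1 hht, mul_nonneg t0 (sub_nonneg.mpr t1),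
          mul_nonneg r0 (sub_nonneg.mpr r1)]
      · nlinarith [mul_nonneg t0 hht]
  rw [hsum]
  calc _ = |M * ((k : ℝ) - (k * θ + k * (k - 1) / 2) / h - h / 2)| := by congr 1; ring
    _ = M * |(k : ℝ) - (k * θ + k * (k - 1) / 2) / h - h / 2| := by rw [abs_mul, abs_of_nonneg hM]
    _ ≤ M * 1 := by gcongr
    _ = M := mul_one M

/-- Integer points in a triangle one of whose sides is horizontal: the section at height `j` is the
interval `[L j, U j]`, of length decreasing linearly from `M` to `0`. -/
lemma half_triangle_count {y₀ h M : ℝ} (hh : 0 < h) (hM : 0 ≤ M) {L U : ℤ → ℝ}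
    (hUL : ∀ j : ℤ, U j - L j = M * (1 - ((j : ℝ) - y₀) / h)) {S : Set (ℤ × ℤ)}
    (h1 : ∀ p ∈ S, y₀ < p.2 ∧ (p.2 : ℝ) ≤ y₀ + h ∧ L p.2 ≤ p.1 ∧ p.1 ≤ U p.2)
    (h2 : ∀ i j : ℤ, y₀ < j → L j < i → i < U j → (i, j) ∈ S) :
    S.Finite ∧ |(S.ncard : ℝ) - M * h / 2| ≤ M + h + 1 := by
  classical
  set J := Finset.Ioc ⌊y₀⌋ ⌊y₀ + h⌋ with hJ
  have hmemJ : ∀ p ∈ S, p.2 ∈ J := fun p hp ↦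
    Finset.mem_Ioc.mpr ⟨Int.floor_lt.mpr (h1 p hp).1, Int.le_floor.mpr (h1 p hp).2.1⟩
  have hfin : S.Finite := by
    refine (Finset.finite_toSet
      (J.biUnion fun j ↦ (Finset.Icc ⌈L j⌉ ⌊U j⌋).image fun i ↦ (i, j))).subset fun p hp ↦ ?_
    rw [Finset.mem_coe, Finset.mem_biUnion]
    exact ⟨p.2, hmemJ p hp, Finset.mem_image.mpr ⟨p.1, Finset.mem_Icc.mpr
      ⟨Int.ceil_le.mpr (h1 p hp).2.2.1, Int.le_floor.mpr (h1 p hp).2.2.2⟩, rfl⟩⟩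
  refine ⟨hfin, ?_⟩
  set F := hfin.toFinset with hF
  have hmF : ∀ p, p ∈ F ↔ p ∈ S := fun p ↦ hfin.mem_toFinset
  have hcard : (S.ncard : ℝ) = ∑ j ∈ J, ((F.filter (fun p ↦ p.2 = j)).card : ℝ) := by
    rw [Set.ncard_eq_toFinset_card S hfin,
      Finset.card_eq_sum_card_fiberwise (f := Prod.snd) (t := J)]
    · push_cast; rfl
    · intro p hp
      exact hmemJ p ((hmF p).mp hp)
  have hfib : ∀ j ∈ J, |((F.filter (fun p ↦ p.2 = j)).card : ℝ) -
      M * (1 - ((j : ℝ) - y₀) / h)| ≤ 1 := by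
    intro j hj
    rw [hJ, Finset.mem_Ioc, Int.floor_lt, Int.le_floor] at hj
    have hc : ((F.filter (fun p ↦ p.2 = j)).image Prod.fst).card =
        (F.filter (fun p ↦ p.2 = j)).card := by
      refine Finset.card_image_of_injOn fun p hp q hq hpq ↦ ?_
      simp only [Finset.coe_filter, Set.mem_ofPred_eq] at hp hq
      exact Prod.ext hpq (hp.2.trans hq.2.symm)
    rw [← hc, ← hUL]
    refine abs_card_Icc_sub_le ?_ ?_ ?_
    · rw [← sub_nonneg, hUL]
      refine mul_nonneg hM (sub_nonneg.mpr ((div_le_one hh).mpr (by linarith)))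
    · intro i hi
      obtain ⟨p, hp, rfl⟩ := Finset.mem_image.mp hi
      rw [Finset.mem_filter, hmF] at hp
      have := h1 p hp.1
      rw [hp.2] at this
      exact this.2.2
    · intro i hi1 hi2
      exact Finset.mem_image.mpr ⟨(i, j), Finset.mem_filter.mpr
        ⟨(hmF _).mpr (h2 i j hj.1 hi1 hi2), rfl⟩, rfl⟩
  have hJcard : (J.card : ℝ) ≤ h + 1 := by
    have hle : ⌊y₀⌋ ≤ ⌊y₀ + h⌋ := Int.floor_le_floor (by linarith)
    have : (J.card : ℤ) = ⌊y₀ + h⌋ - ⌊y₀⌋ := by rw [hJ, Int.card_Ioc]; omega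
    have h' : (J.card : ℝ) = (⌊y₀ + h⌋ : ℝ) - ⌊y₀⌋ := by exact_mod_cast this
    linarith [Int.floor_le (y₀ + h), Int.lt_floor_add_one y₀]
  have hs1 : |∑ j ∈ J, (((F.filter (fun p ↦ p.2 = j)).card : ℝ) -
      M * (1 - ((j : ℝ) - y₀) / h))| ≤ h + 1 :=
    calc _ ≤ ∑ j ∈ J, |((F.filter (fun p ↦ p.2 = j)).card : ℝ) -
          M * (1 - ((j : ℝ) - y₀) / h)| := Finset.abs_sum_le_sum_abs _ _
      _ ≤ ∑ j ∈ J, (1 : ℝ) := Finset.sum_le_sum hfib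
      _ = J.card := by simp
      _ ≤ h + 1 := hJcard
  have hs2 := abs_sum_linear_sub_le (y₀ := y₀) hh hM
  rw [Finset.sum_sub_distrib, ← hcard] at hs1
  calc _ ≤ _ := abs_sub_le _ (∑ j ∈ J, M * (1 - ((j : ℝ) - y₀) / h)) _
    _ ≤ (h + 1) + M := add_le_add hs1 hs2
    _ = _ := by ring

/-- Write `F₁, F₂` for the two affine forms. The height `y₀` is that of the vertex `F₁ = F₂ = 0`. As
`A₁ F₂ - A₂ F₁ = Δ (y - y₀)`, above this vertex `F₁ > 0` forces `F₂ > 0`, so only the sides `F₁ = 0`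
and `F₁ + F₂ = W` bound the rows. They meet at height `y₀ + W A₁ / Δ`. -/
lemma triangle_upper_part {A₁ A₂ B₁ B₂ C₁ C₂ W Δ y₀ : ℝ} (hA₁ : 0 ≤ A₁) (hA₂ : 0 ≤ A₂)
    (hA : 0 < A₁ + A₂) (hW : 0 < W) (hΔ : 0 < Δ) (hΔe : Δ = A₁ * B₂ - A₂ * B₁)
    (hy : Δ * y₀ = A₂ * C₁ - A₁ * C₂) {S : Set (ℤ × ℤ)}
    (h1 : ∀ p ∈ S, y₀ < p.2 ∧ 0 ≤ A₁ * p.1 + B₁ * p.2 + C₁ ∧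
      (A₁ * p.1 + B₁ * p.2 + C₁) + (A₂ * p.1 + B₂ * p.2 + C₂) ≤ W)
    (h2 : ∀ i j : ℤ, y₀ < j → 0 < A₁ * i + B₁ * j + C₁ → 0 < A₂ * i + B₂ * j + C₂ →
      (A₁ * i + B₁ * j + C₁) + (A₂ * i + B₂ * j + C₂) < W → (i, j) ∈ S) :
    S.Finite ∧ |(S.ncard : ℝ) - W / (A₁ + A₂) * (W * A₁ / Δ) / 2| ≤
      W / (A₁ + A₂) + W * A₁ / Δ + 1 := by
  have hdet : ∀ x y : ℝ, A₁ * (A₂ * x + B₂ * y + C₂) - A₂ * (A₁ * x + B₁ * y + C₁) =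
      Δ * (y - y₀) := fun x y ↦ by rw [mul_sub, hy, hΔe]; ring
  rcases hA₁.eq_or_lt with h0 | hA₁'
  -- If `A₁ = 0` the side `F₁ = 0` is horizontal and nothing lies above `y₀`.
  · have hS : S = ∅ := by
      refine Set.eq_empty_of_forall_notMem fun p hp ↦ ?_
      obtain ⟨a1, a2, -⟩ := h1 p hp
      have hd := hdet p.1 p.2
      have : 0 < Δ * ((p.2 : ℝ) - y₀) := mul_pos hΔ (sub_pos.mpr a1)
      rw [← h0, zero_mul] at hd
      rw [← h0] at a2
      linarith [mul_nonneg hA₂ a2]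
    rw [hS, ← h0]
    simp only [Set.finite_empty, Set.ncard_empty, true_and, mul_zero, zero_div, Nat.cast_zero,
      sub_zero, abs_zero, zero_add, add_zero]
    rw [← h0, zero_add] at hA
    positivity
  refine half_triangle_count (h := W * A₁ / Δ) (M := W / (A₁ + A₂)) (y₀ := y₀)
    (L := fun j ↦ -(B₁ * j + C₁) / A₁) (U := fun j ↦ (W - C₁ - C₂ - (B₁ + B₂) * j) / (A₁ + A₂))
    (by positivity) (by positivity) ?_ ?_ ?_
  · intro j
    field_simp
    linear_combination (j : ℝ) * hΔe - hy
  · intro p hp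
    obtain ⟨a1, a2, a3⟩ := h1 p hp
    have hd := hdet p.1 p.2
    refine ⟨a1, ?_, ?_, ?_⟩
    · rw [← sub_le_iff_le_add', le_div_iff₀ hΔ]
      nlinarith [mul_nonneg hA.le a2, mul_nonneg hA₁ (sub_nonneg.mpr a3)]
    · rw [div_le_iff₀ hA₁']; linarith
    · rw [le_div_iff₀ hA]; linarith
  · intro i j a1 a2 a3
    rw [div_lt_iff₀ hA₁'] at a2
    rw [lt_div_iff₀ hA] at a3
    have hd := hdet i j
    have hF : 0 < A₁ * i + B₁ * j + C₁ := by linarith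
    refine h2 i j a1 hF ?_ (by linarith)
    have : 0 < Δ * ((j : ℝ) - y₀) := mul_pos hΔ (sub_pos.mpr a1)
    have : 0 < A₁ * (A₂ * i + B₂ * j + C₂) := by nlinarith [mul_nonneg hA₂ hF.le]
    exact pos_of_mul_pos_right this hA₁

lemma ncard_preimage_equiv (e : ℤ × ℤ ≃ ℤ × ℤ) (S : Set (ℤ × ℤ)) :
    (e ⁻¹' S).ncard = S.ncard := by
  conv_rhs => rw [← Set.image_preimage_eq S e.surjective]
  exact (Set.ncard_image_of_injective _ e.injective).symm

lemma finite_of_preimage_equiv (e : ℤ × ℤ ≃ ℤ × ℤ) {S : Set (ℤ × ℤ)}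
    (h : (e ⁻¹' S).Finite) : S.Finite := by
  rw [← Set.image_preimage_eq S e.surjective]
  exact h.image _

/-- The horizontal line through the middle vertex cuts the triangle into two halves, each with a
horizontal side of length `W / (A₁ + A₂)`. The points on the cut form a single row. -/
lemma triangle_count_of_nonneg {A₁ A₂ B₁ B₂ C₁ C₂ W Δ : ℝ} (hA₁ : 0 ≤ A₁) (hA₂ : 0 ≤ A₂)
    (hA : 0 < A₁ + A₂) (hW : 0 < W) (hΔ : 0 < Δ) (hΔe : Δ = A₁ * B₂ - A₂ * B₁)
    {S : Set (ℤ × ℤ)}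
    (h1 : ∀ p ∈ S, 0 ≤ A₁ * p.1 + B₁ * p.2 + C₁ ∧ 0 ≤ A₂ * p.1 + B₂ * p.2 + C₂ ∧
      (A₁ * p.1 + B₁ * p.2 + C₁) + (A₂ * p.1 + B₂ * p.2 + C₂) ≤ W)
    (h2 : ∀ i j : ℤ, 0 < A₁ * i + B₁ * j + C₁ → 0 < A₂ * i + B₂ * j + C₂ →
      (A₁ * i + B₁ * j + C₁) + (A₂ * i + B₂ * j + C₂) < W → (i, j) ∈ S) :
    S.Finite ∧ |(S.ncard : ℝ) - W ^ 2 / (2 * Δ)| ≤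
      3 * W / (A₁ + A₂) + W * (A₁ + A₂) / Δ + 3 := by
  obtain ⟨y₀, hy⟩ : ∃ y₀, Δ * y₀ = A₂ * C₁ - A₁ * C₂ :=
    ⟨(A₂ * C₁ - A₁ * C₂) / Δ, by field_simp⟩
  obtain ⟨f1, c1⟩ := triangle_upper_part hA₁ hA₂ hA hW hΔ hΔe hy (S := {p ∈ S | y₀ < p.2})
    (fun p hp ↦ ⟨hp.2, (h1 p hp.1).1, (h1 p hp.1).2.2⟩)
    (fun i j a1 a2 a3 a4 ↦ ⟨h2 i j a2 a3 a4, a1⟩)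
  -- The reflection `j ↦ -j` turns the lower half into an upper half with the two forms exchanged.
  let e : ℤ × ℤ ≃ ℤ × ℤ := (Equiv.refl ℤ).prodCongr (Equiv.neg ℤ)
  have he : ∀ i j : ℤ, e (i, j) = (i, -j) := fun i j ↦ rfl
  obtain ⟨f2, c2⟩ := triangle_upper_part (B₁ := -B₂) (B₂ := -B₁) (C₁ := C₂) (C₂ := C₁)
    (y₀ := -y₀) (Δ := Δ) (W := W) hA₂ hA₁ (by linarith) hW hΔ (by linarith) (by linarith)
    (S := e ⁻¹' ({p : ℤ × ℤ | p ∈ S ∧ (p.2 : ℝ) < y₀} : Set (ℤ × ℤ)))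
    (by
      rintro ⟨i, j⟩ ⟨hp, hp'⟩
      rw [he] at hp hp'
      have := h1 _ hp
      push_cast at this hp' ⊢
      exact ⟨by linarith, by linarith, by linarith⟩)
    (by
      intro i j a1 a2 a3 a4
      rw [Set.mem_preimage, he]
      refine ⟨h2 _ _ ?_ ?_ ?_, ?_⟩ <;> push_cast <;> linarith)
  rw [ncard_preimage_equiv] at c2
  replace f2 := finite_of_preimage_equiv e f2
  have h3 : {p ∈ S | (p.2 : ℝ) = y₀}.Finite ∧
      ({p ∈ S | (p.2 : ℝ) = y₀}.ncard : ℝ) ≤ W / (A₁ + A₂) + 1 := by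
    obtain ⟨k, hk⟩ : ∃ k : ℝ, k = (-(C₁ + C₂) - (B₁ + B₂) * y₀) / (A₁ + A₂) := ⟨_, rfl⟩
    have hsub : {p ∈ S | (p.2 : ℝ) = y₀} ⊆
        ((Finset.Icc ⌈k⌉ ⌊k + W / (A₁ + A₂)⌋).image fun i ↦ (i, ⌊y₀⌋) : Finset (ℤ × ℤ)) := by
      rintro p ⟨hp, hp'⟩
      obtain ⟨a1, a2, a3⟩ := h1 p hp
      rw [hp'] at a1 a2 a3
      rw [Finset.mem_coe, Finset.mem_image]
      refine ⟨p.1, Finset.mem_Icc.mpr ⟨Int.ceil_le.mpr ?_, Int.le_floor.mpr ?_⟩, ?_⟩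
      · rw [hk, div_le_iff₀ hA]; linarith
      · rw [hk, ← add_div, le_div_iff₀ hA]; linarith
      · rw [← hp', Int.floor_intCast]
    refine ⟨(Finset.finite_toSet _).subset hsub, ?_⟩
    have hle := (Set.ncard_le_ncard hsub (Finset.finite_toSet _)).trans
      ((Set.ncard_coe_finset _).le.trans Finset.card_image_le)
    rw [Int.card_Icc] at hle
    have hMp : 0 ≤ W / (A₁ + A₂) := by positivity
    have hz : (⌊k + W / (A₁ + A₂)⌋ + 1 - ⌈k⌉) ≤ ⌊W / (A₁ + A₂)⌋ + 1 := by
      have : ⌊k + W / (A₁ + A₂)⌋ - ⌈k⌉ ≤ ⌊W / (A₁ + A₂)⌋ := by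
        rw [Int.le_floor]
        push_cast
        linarith [Int.floor_le (k + W / (A₁ + A₂)), Int.le_ceil k]
      linarith
    have hfl : 0 ≤ ⌊W / (A₁ + A₂)⌋ := Int.floor_nonneg.mpr hMp
    have : (({p ∈ S | (p.2 : ℝ) = y₀}.ncard : ℕ) : ℤ) ≤ ⌊W / (A₁ + A₂)⌋ + 1 := by omega
    have : (({p ∈ S | (p.2 : ℝ) = y₀}.ncard : ℕ) : ℝ) ≤ (⌊W / (A₁ + A₂)⌋ : ℝ) + 1 := by
      exact_mod_cast this
    linarith [Int.floor_le (W / (A₁ + A₂))]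
  obtain ⟨f3, c3⟩ := h3
  have hunion : S = {p ∈ S | y₀ < p.2} ∪ {p ∈ S | (p.2 : ℝ) < y₀} ∪ {p ∈ S | (p.2 : ℝ) = y₀} := by
    ext p
    constructor
    · intro hp
      rcases lt_trichotomy y₀ p.2 with h | h | h
      · exact Or.inl (Or.inl ⟨hp, h⟩)
      · exact Or.inr ⟨hp, h.symm⟩
      · exact Or.inl (Or.inr ⟨hp, h⟩)
    · rintro ((h | h) | h) <;> exact h.1
  have hncard : S.ncard = {p ∈ S | y₀ < p.2}.ncard + {p ∈ S | (p.2 : ℝ) < y₀}.ncard +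
      {p ∈ S | (p.2 : ℝ) = y₀}.ncard := by
    conv_lhs => rw [hunion]
    rw [Set.ncard_union_eq _ (f1.union f2) f3, Set.ncard_union_eq _ f1 f2]
    · rw [Set.disjoint_left]
      rintro p ⟨-, h⟩ ⟨-, h'⟩
      exact lt_asymm h h'
    · rw [Set.disjoint_left]
      rintro p (⟨-, h⟩ | ⟨-, h⟩) ⟨-, h'⟩
      · exact h.ne' h'
      · exact h.ne h'
  refine ⟨by rw [hunion]; exact (f1.union f2).union f3, ?_⟩
  rw [hncard]
  push_cast
  have e1 : W ^ 2 / (2 * Δ) = W / (A₁ + A₂) * (W * A₁ / Δ) / 2 +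
      W / (A₂ + A₁) * (W * A₂ / Δ) / 2 := by rw [add_comm A₂]; field_simp
  have e2 : W * (A₁ + A₂) / Δ = W * A₁ / Δ + W * A₂ / Δ := by ring
  have e3 : 3 * W / (A₁ + A₂) = W / (A₁ + A₂) + W / (A₂ + A₁) + W / (A₁ + A₂) := by
    rw [add_comm A₂]; ring
  have c4 : (0 : ℝ) ≤ {p ∈ S | (p.2 : ℝ) = y₀}.ncard := Nat.cast_nonneg _
  rw [e1, e2, e3]
  rw [abs_le] at c1 c2 ⊢
  constructor <;> linarith [c1.1, c1.2, c2.1, c2.2]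

/-- The number of integer points in a triangle given by three affine forms whose sum is constant;
the first coefficients of the forms only enter through bounds for their maximum. -/
lemma triangle_count {A₁ A₂ A₃ B₁ B₂ B₃ C₁ C₂ C₃ W Δ lo hi : ℝ} (hW : 0 < W) (hΔ : 0 < Δ)
    (hA : A₁ + A₂ + A₃ = 0) (hB : B₁ + B₂ + B₃ = 0) (hC : C₁ + C₂ + C₃ = W)
    (hΔe : Δ = A₁ * B₂ - A₂ * B₁) (hlo : 0 < lo)
    (hlo' : ∀ A, |A₁| ≤ A → |A₂| ≤ A → |A₃| ≤ A → lo ≤ A)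
    (hhi₁ : |A₁| ≤ hi) (hhi₂ : |A₂| ≤ hi) (hhi₃ : |A₃| ≤ hi) {S : Set (ℤ × ℤ)}
    (h1 : ∀ p ∈ S, 0 ≤ A₁ * p.1 + B₁ * p.2 + C₁ ∧ 0 ≤ A₂ * p.1 + B₂ * p.2 + C₂ ∧
      0 ≤ A₃ * p.1 + B₃ * p.2 + C₃)
    (h2 : ∀ i j : ℤ, 0 < A₁ * i + B₁ * j + C₁ → 0 < A₂ * i + B₂ * j + C₂ →
      0 < A₃ * i + B₃ * j + C₃ → (i, j) ∈ S) :
    S.Finite ∧ |(S.ncard : ℝ) - W ^ 2 / (2 * Δ)| ≤ 3 * W / lo + W * hi / Δ + 3 := by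
  have hsum : ∀ x y : ℝ, (A₁ * x + B₁ * y + C₁) + (A₂ * x + B₂ * y + C₂) +
      (A₃ * x + B₃ * y + C₃) = W := fun x y ↦ by
    linear_combination x * hA + y * hB + hC
  -- After normalization the largest `|Aᵢ|` is `A₁ + A₂`; one error term decreases in it and the
  -- other increases, so `lo` and `hi` suffice.
  have mono : ∀ A, lo ≤ A → A ≤ hi → 3 * W / A + W * A / Δ + 3 ≤ 3 * W / lo + W * hi / Δ + 3 := by
    intro A h h'
    gcongr
  have main : ∀ {A₁ A₂ A₃ B₁ B₂ B₃ C₁ C₂ C₃ : ℝ}, 0 ≤ A₁ → 0 ≤ A₂ →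
      A₁ + A₂ + A₃ = 0 → (∀ A, |A₁| ≤ A → |A₂| ≤ A → |A₃| ≤ A → lo ≤ A) → |A₃| ≤ hi →
      Δ = A₁ * B₂ - A₂ * B₁ → ∀ {S : Set (ℤ × ℤ)},
      (∀ x y : ℝ, (A₁ * x + B₁ * y + C₁) + (A₂ * x + B₂ * y + C₂) +
        (A₃ * x + B₃ * y + C₃) = W) →
      (∀ p ∈ S, 0 ≤ A₁ * p.1 + B₁ * p.2 + C₁ ∧ 0 ≤ A₂ * p.1 + B₂ * p.2 + C₂ ∧
        0 ≤ A₃ * p.1 + B₃ * p.2 + C₃) →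
      (∀ i j : ℤ, 0 < A₁ * i + B₁ * j + C₁ → 0 < A₂ * i + B₂ * j + C₂ →
        0 < A₃ * i + B₃ * j + C₃ → (i, j) ∈ S) →
      S.Finite ∧ |(S.ncard : ℝ) - W ^ 2 / (2 * Δ)| ≤ 3 * W / lo + W * hi / Δ + 3 := by
    intro A₁ A₂ A₃ B₁ B₂ B₃ C₁ C₂ C₃ p1 p2 hA hlo' hhi hΔe S hsum h1 h2
    have hA3 : |A₃| = A₁ + A₂ := by rw [abs_of_nonpos (by linarith)]; linarith
    have hl : lo ≤ A₁ + A₂ := hlo' _ (by rw [abs_of_nonneg p1]; linarith)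
      (by rw [abs_of_nonneg p2]; linarith) hA3.le
    obtain ⟨f, c⟩ := triangle_count_of_nonneg p1 p2 (hlo.trans_le hl) hW hΔ hΔe (S := S)
      (fun p hp ↦ ⟨(h1 p hp).1, (h1 p hp).2.1, by linarith [(h1 p hp).2.2, hsum p.1 p.2]⟩)
      (fun i j a1 a2 a3 ↦ h2 i j a1 a2 (by linarith [hsum i j]))
    exact ⟨f, c.trans (mono _ hl (hA3 ▸ hhi))⟩
  have cyc : ∀ {A₁ A₂ A₃ B₁ B₂ B₃ : ℝ}, A₁ + A₂ + A₃ = 0 → B₁ + B₂ + B₃ = 0 →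
      (∀ A, |A₁| ≤ A → |A₂| ≤ A → |A₃| ≤ A → lo ≤ A) →
      |A₁| ≤ hi → |A₂| ≤ hi → |A₃| ≤ hi → Δ = A₁ * B₂ - A₂ * B₁ → ∀ {S : Set (ℤ × ℤ)},
      (∀ x y : ℝ, (A₁ * x + B₁ * y + C₁) + (A₂ * x + B₂ * y + C₂) +
        (A₃ * x + B₃ * y + C₃) = W) →
      (∀ p ∈ S, 0 ≤ A₁ * p.1 + B₁ * p.2 + C₁ ∧ 0 ≤ A₂ * p.1 + B₂ * p.2 + C₂ ∧
        0 ≤ A₃ * p.1 + B₃ * p.2 + C₃) →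
      (∀ i j : ℤ, 0 < A₁ * i + B₁ * j + C₁ → 0 < A₂ * i + B₂ * j + C₂ →
        0 < A₃ * i + B₃ * j + C₃ → (i, j) ∈ S) →
      (0 ≤ A₁ ∧ 0 ≤ A₂ ∨ 0 ≤ A₂ ∧ 0 ≤ A₃ ∨ 0 ≤ A₃ ∧ 0 ≤ A₁) →
      S.Finite ∧ |(S.ncard : ℝ) - W ^ 2 / (2 * Δ)| ≤ 3 * W / lo + W * hi / Δ + 3 := by
    intro A₁ A₂ A₃ B₁ B₂ B₃ hA hB hlo' b1 b2 b3 hΔe S hsum h1 h2 hcase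
    rcases hcase with ⟨p1, p2⟩ | ⟨p1, p2⟩ | ⟨p1, p2⟩
    · exact main p1 p2 hA hlo' b3 hΔe hsum h1 h2
    · refine main (A₃ := A₁) (B₃ := B₁) (C₃ := C₁) p1 p2 (by linarith)
        (fun A a b c ↦ hlo' A c a b) b1 ?_ (fun x y ↦ by linarith [hsum x y])
        (fun p hp ↦ ⟨(h1 p hp).2.1, (h1 p hp).2.2, (h1 p hp).1⟩)
        (fun i j a b c ↦ h2 i j c a b)
      linear_combination hΔe + B₂ * hA - A₂ * hB
    · refine main (A₃ := A₂) (B₃ := B₂) (C₃ := C₂) p1 p2 (by linarith)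
        (fun A a b c ↦ hlo' A b c a) b2 ?_ (fun x y ↦ by linarith [hsum x y])
        (fun p hp ↦ ⟨(h1 p hp).2.2, (h1 p hp).1, (h1 p hp).2.1⟩)
        (fun i j a b c ↦ h2 i j b c a)
      linear_combination hΔe - B₁ * hA + A₁ * hB
  -- Among three reals two are nonnegative or two are negative; the latter case is reduced to the
  -- former by `p ↦ -p`.
  by_cases hcase : 0 ≤ A₁ ∧ 0 ≤ A₂ ∨ 0 ≤ A₂ ∧ 0 ≤ A₃ ∨ 0 ≤ A₃ ∧ 0 ≤ A₁
  · exact cyc hA hB hlo' hhi₁ hhi₂ hhi₃ hΔe hsum h1 h2 hcase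
  · have hcase' : 0 ≤ -A₁ ∧ 0 ≤ -A₂ ∨ 0 ≤ -A₂ ∧ 0 ≤ -A₃ ∨ 0 ≤ -A₃ ∧ 0 ≤ -A₁ := by
      simp only [not_or, not_and_or, not_le] at hcase
      obtain ⟨c1 | c1, c2 | c2, c3 | c3⟩ := hcase
      · left; constructor <;> linarith
      · left; constructor <;> linarith
      · right; right; constructor <;> linarith
      · right; right; constructor <;> linarith
      · right; left; constructor <;> linarith
      · left; constructor <;> linarith
      · right; left; constructor <;> linarith
      · left; constructor <;> linarith
    have he : ∀ p, Equiv.neg (ℤ × ℤ) p = (-p.1, -p.2) := fun p ↦ rfl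
    have := cyc (A₁ := -A₁) (A₂ := -A₂) (A₃ := -A₃) (B₁ := -B₁) (B₂ := -B₂) (B₃ := -B₃)
      (by linarith) (by linarith) (by simpa only [abs_neg] using hlo') (by rwa [abs_neg])
      (by rwa [abs_neg]) (by rwa [abs_neg]) (by linarith) (S := Equiv.neg (ℤ × ℤ) ⁻¹' S)
      (fun x y ↦ by linarith [hsum (-x) (-y)])
      (fun p hp ↦ by
        have := h1 _ hp
        rw [he] at this
        push_cast at this
        refine ⟨?_, ?_, ?_⟩ <;> linarith)
      (fun i j a b c ↦ by
        rw [Set.mem_preimage, he]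
        refine h2 _ _ ?_ ?_ ?_ <;> push_cast <;> linarith) hcase'
    rw [ncard_preimage_equiv] at this
    exact ⟨finite_of_preimage_equiv _ this.1, this.2⟩

/-! ### Small vectors and adapted bases -/

/-- Minkowski's theorem for the box `|u - α v| < h`, `|v| ≤ m / h`. -/
lemma exists_mem_cyclicLattice_small (w₀ : ℤ × ℤ) {m : ℕ} (hm : 0 < m) (α : ℝ) {h : ℝ}
    (hh : 0 < h) : ∃ w ∈ cyclicLattice w₀ m, w ≠ 0 ∧ |(w.1 : ℝ) - α * w.2| < h ∧
      |(w.2 : ℝ)| ≤ m / h := by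
  obtain ⟨k, hk⟩ : ∃ k : ℕ, k = ⌊(m : ℝ) / h⌋₊ := ⟨_, rfl⟩
  have hk1 : (m : ℝ) / h < k + 1 := hk ▸ Nat.lt_floor_add_one _
  have hk2 : (k : ℝ) ≤ m / h := hk ▸ Nat.floor_le (by positivity)
  -- Pigeonhole on `N` points to the right of the line `u = αv` in each row `0 ≤ v ≤ k`, sorted by
  -- the residue of the determinant mod `m` and by `⌊(u - αv)/h⌋`. Since `k + 1 > m/h`, a large `N`
  -- makes `(k + 1) N` points exceed `m (⌊N/h⌋ + 1)` boxes.
  obtain ⟨N, hN⟩ := exists_nat_gt ((m : ℝ) / (k + 1 - m / h))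
  rw [div_lt_iff₀ (by linarith)] at hN
  let s : Finset (ℕ × ℕ) := Finset.range (k + 1) ×ˢ Finset.range N
  let t : Finset (ℤ × ℤ) := Finset.Ico 0 (m : ℤ) ×ˢ Finset.Icc 0 ⌊(N : ℝ) / h⌋
  let g : ℕ × ℕ → ℤ × ℤ := fun x ↦ (⌈α * (x.1 : ℝ)⌉ + x.2, x.1)
  let f : ℕ × ℕ → ℤ × ℤ := fun x ↦
    (detForm w₀ (g x) % m, ⌊(((g x).1 : ℝ) - α * (g x).2) / h⌋)
  have hx : ∀ x : ℕ × ℕ, ((g x).1 : ℝ) - α * (g x).2 = ⌈α * (x.1 : ℝ)⌉ - α * x.1 + x.2 :=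
    fun x ↦ by simp only [g]; push_cast; ring
  have hcard : t.card < s.card := by
    have e1 : (t.card : ℤ) = m * (⌊(N : ℝ) / h⌋ + 1) := by
      have : 0 ≤ ⌊(N : ℝ) / h⌋ := Int.floor_nonneg.mpr (by positivity)
      rw [Finset.card_product, Int.card_Ico, Int.card_Icc]
      push_cast
      rw [Int.toNat_of_nonneg (by omega), Int.toNat_of_nonneg (by omega)]
      ring
    have e2 : s.card = (k + 1) * N := by
      rw [Finset.card_product, Finset.card_range, Finset.card_range]
    have e3 : (t.card : ℝ) = m * ((⌊(N : ℝ) / h⌋ : ℝ) + 1) := by exact_mod_cast e1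
    have : (t.card : ℝ) < s.card := by
      rw [e3, e2]
      push_cast
      calc (m : ℝ) * ((⌊(N : ℝ) / h⌋ : ℝ) + 1) ≤ m * (N / h + 1) := by
            gcongr; exact Int.floor_le _
        _ < (k + 1) * N := by
            have : (m : ℝ) * (N / h) = N * (m / h) := by ring
            linarith
    exact_mod_cast this
  have hmaps : ∀ x ∈ s, f x ∈ t := by
    intro x hxs
    have hx2 : x.2 < N := Finset.mem_range.mp (Finset.mem_product.mp hxs).2
    have hx2' : (x.2 : ℝ) + 1 ≤ N := by exact_mod_cast hx2
    have hm' : (m : ℤ) ≠ 0 := by exact_mod_cast hm.ne'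
    refine Finset.mem_product.mpr ⟨Finset.mem_Ico.mpr ⟨Int.emod_nonneg _ hm',
      Int.emod_lt_of_pos _ (by exact_mod_cast hm)⟩, Finset.mem_Icc.mpr ⟨?_, ?_⟩⟩
    · refine Int.floor_nonneg.mpr (div_nonneg ?_ hh.le)
      rw [hx]
      linarith [Int.le_ceil (α * (x.1 : ℝ)), (Nat.cast_nonneg x.2 : (0 : ℝ) ≤ _)]
    · refine Int.floor_le_floor ?_
      gcongr
      rw [hx]
      linarith [Int.ceil_lt_add_one (α * (x.1 : ℝ))]
  obtain ⟨x, hxs, y, hys, hxy, hfxy⟩ := Finset.exists_ne_map_eq_of_card_lt_of_maps_to hcard hmaps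
  have hf1 : detForm w₀ (g x) % m = detForm w₀ (g y) % m := congrArg Prod.fst hfxy
  have hf2 : ⌊(((g x).1 : ℝ) - α * (g x).2) / h⌋ = ⌊(((g y).1 : ℝ) - α * (g y).2) / h⌋ :=
    congrArg Prod.snd hfxy
  refine ⟨g x - g y, ?_, ?_, ?_, ?_⟩
  · rw [mem_cyclicLattice, ← detForm_apply, map_sub]
    exact Int.ModEq.dvd (n := m) hf1.symm
  · intro h0
    rw [sub_eq_zero] at h0
    have a2 : (x.1 : ℤ) = y.1 := congrArg Prod.snd h0
    have a2' : x.1 = y.1 := by exact_mod_cast a2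
    have a1 : ⌈α * (x.1 : ℝ)⌉ + (x.2 : ℤ) = ⌈α * (y.1 : ℝ)⌉ + y.2 := congrArg Prod.fst h0
    rw [a2'] at a1
    exact hxy (Prod.ext a2' (by omega))
  · have := Int.abs_sub_lt_one_of_floor_eq_floor hf2
    rw [← sub_div, abs_div, abs_of_pos hh, div_lt_one hh] at this
    refine lt_of_eq_of_lt ?_ this
    congr 1
    rw [Prod.fst_sub, Prod.snd_sub]
    push_cast
    ring
  · have hx1 : x.1 < k + 1 := Finset.mem_range.mp (Finset.mem_product.mp hxs).1
    have hy1 : y.1 < k + 1 := Finset.mem_range.mp (Finset.mem_product.mp hys).1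
    have : |(g x - g y).2| ≤ (k : ℤ) := by
      change |(x.1 : ℤ) - y.1| ≤ k
      rw [abs_le]
      omega
    exact le_trans (by exact_mod_cast this) hk2

/-- A lattice given by one congruence has a basis `(e₁, e₂)` of determinant `m` whose first vector
is small. -/
lemma exists_basis_cyclicLattice {w₀ : ℤ × ℤ} (hw₀ : IsPrimitive w₀) {m : ℕ} (hm : 0 < m) (α : ℝ)
    {h : ℝ} (hh : 0 < h) : ∃ e₁ e₂ : ℤ × ℤ, e₁ ≠ 0 ∧ |(e₁.1 : ℝ) - α * e₁.2| < h ∧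
      |(e₁.2 : ℝ)| ≤ m / h ∧ e₁.1 * e₂.2 - e₁.2 * e₂.1 = m ∧
      ∀ w, w ∈ cyclicLattice w₀ m ↔ ∃ i j : ℤ, w = i • e₁ + j • e₂ := by
  obtain ⟨w₁, hw₁⟩ := hw₀.exists_bezout
  obtain ⟨w, hw, hw0, hx, hv⟩ := exists_mem_cyclicLattice_small w₀ hm α hh
  rw [mem_cyclicLattice] at hw
  obtain ⟨j, hj⟩ := hw
  -- In the basis `(w₀, m w₁)` of the lattice the small vector is `(i, j)`. Dividing by `gcd(i, j)`
  -- only shrinks it, and the resulting coprime pair completes to a unimodular matrix.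
  obtain ⟨i, hi⟩ : ∃ i, i = w.1 * w₁.2 - w.2 * w₁.1 := ⟨_, rfl⟩
  have hwa : w.1 = i * w₀.1 + m * j * w₁.1 := by
    rw [hi, ← hj]; linear_combination (-w.1) * hw₁
  have hwb : w.2 = i * w₀.2 + m * j * w₁.2 := by
    rw [hi, ← hj]; linear_combination (-w.2) * hw₁
  have hij : 0 < Int.gcd i j := by
    rw [Int.gcd_pos_iff]
    by_contra! hc
    refine hw0 (Prod.ext ?_ ?_)
    · rw [hwa, hc.1, hc.2]; simp
    · rw [hwb, hc.1, hc.2]; simp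
  obtain ⟨p, hp⟩ := Int.gcd_dvd_left i j
  obtain ⟨q, hq⟩ := Int.gcd_dvd_right i j
  obtain ⟨g, hg⟩ : ∃ g : ℤ, g = Int.gcd i j := ⟨_, rfl⟩
  rw [← hg] at hp hq
  have hg1 : 1 ≤ g := by omega
  obtain ⟨s, r, hrs⟩ : ∃ s r : ℤ, p * s - q * r = 1 := by
    have hb := Int.gcd_eq_gcd_ab i j
    rw [← hg] at hb
    refine ⟨Int.gcdA i j, -Int.gcdB i j, ?_⟩
    have : g * (p * Int.gcdA i j - q * -Int.gcdB i j) = g * 1 := by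
      rw [mul_one]
      conv_rhs => rw [hb]
      linear_combination (-Int.gcdA i j) * hp - Int.gcdB i j * hq
    exact mul_left_cancel₀ (by omega) this
  have hx1 : w.1 = g * (p * w₀.1 + q * m * w₁.1) := by rw [hwa, hp, hq]; ring
  have hx2 : w.2 = g * (p * w₀.2 + q * m * w₁.2) := by rw [hwb, hp, hq]; ring
  have hgR : (1 : ℝ) ≤ g := by exact_mod_cast hg1
  have hscale : ∀ z : ℝ, |z| ≤ |(g : ℝ) * z| := fun z ↦ by
    rw [abs_mul, abs_of_nonneg (by linarith : (0 : ℝ) ≤ g)]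
    exact le_mul_of_one_le_left (abs_nonneg _) hgR
  refine ⟨(p * w₀.1 + q * m * w₁.1, p * w₀.2 + q * m * w₁.2),
    (r * w₀.1 + s * m * w₁.1, r * w₀.2 + s * m * w₁.2), ?_, ?_, ?_, ?_, ?_⟩
  · intro h0
    refine hw0 (Prod.ext ?_ ?_)
    · rw [hx1, show p * w₀.1 + q * m * w₁.1 = 0 from congrArg Prod.fst h0]; simp
    · rw [hx2, show p * w₀.2 + q * m * w₁.2 = 0 from congrArg Prod.snd h0]; simp
  · refine (hscale _).trans_lt (lt_of_eq_of_lt ?_ hx)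
    rw [hx1, hx2]
    push_cast
    congr 1
    ring
  · refine (hscale _).trans (le_of_eq_of_le ?_ hv)
    rw [hx2]
    push_cast
    rfl
  · simp only
    linear_combination (m : ℤ) * (p * s - q * r) * hw₁ + (m : ℤ) * hrs
  · intro z
    rw [mem_cyclicLattice]
    constructor
    · rintro ⟨b, hb⟩
      obtain ⟨a, ha⟩ : ∃ a, a = z.1 * w₁.2 - z.2 * w₁.1 := ⟨_, rfl⟩
      have hza : z.1 = a * w₀.1 + m * b * w₁.1 := by
        rw [ha, ← hb]; linear_combination (-z.1) * hw₁
      have hzb : z.2 = a * w₀.2 + m * b * w₁.2 := by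
        rw [ha, ← hb]; linear_combination (-z.2) * hw₁
      refine ⟨a * s - b * r, b * p - a * q, Prod.ext ?_ ?_⟩
      · simp only [Prod.fst_add, Prod.smul_fst, smul_eq_mul]
        rw [hza]
        linear_combination (-(a * w₀.1 + m * b * w₁.1)) * hrs
      · simp only [Prod.snd_add, Prod.smul_snd, smul_eq_mul]
        rw [hzb]
        linear_combination (-(a * w₀.2 + m * b * w₁.2)) * hrs
    · rintro ⟨a, b, rfl⟩
      refine ⟨a * q + b * s, ?_⟩
      simp only [Prod.fst_add, Prod.smul_fst, Prod.snd_add, Prod.smul_snd, smul_eq_mul]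
      linear_combination ((m : ℤ) * (a * q + b * s)) * hw₁

/-! ### Lattice points in a thin triangle of quadratic irrational slope -/

/-- The integer points of the triangle `0 < u - α v ≤ δ v`, `v ≤ V`. -/
def thinTriangle (α δ V : ℝ) : Set (ℤ × ℤ) :=
  {w | 0 < (w.1 : ℝ) - α * w.2 ∧ (w.1 : ℝ) - α * w.2 ≤ δ * w.2 ∧ (w.2 : ℝ) ≤ V}

/-- The norm form is bounded below at nonzero integer points. -/
lemma one_le_norm_form {a b : ℕ} {α : ℝ} (ha : 0 < a) (hab : (a : ℝ) * α ^ 2 = b) (hirr : Irrational α)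
    {w : ℤ × ℤ} (hw : w ≠ 0) :
    1 ≤ a * (|(w.1 : ℝ) - α * w.2| * |(w.1 : ℝ) + α * w.2|) := by
  have hne : ∀ (z : ℝ), z = α ∨ z = -α → (w.1 : ℝ) - z * w.2 ≠ 0 := by
    intro z hz h0
    have hz' : Irrational z := by
      rcases hz with rfl | rfl
      · exact hirr
      · exact hirr.neg
    by_cases h2 : w.2 = 0
    · rw [h2, Int.cast_zero, mul_zero, sub_zero, Int.cast_eq_zero] at h0
      exact hw (Prod.ext h0 h2)
    · have h2' : (w.2 : ℝ) ≠ 0 := by exact_mod_cast h2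
      refine hz' ⟨(w.1 : ℚ) / w.2, ?_⟩
      push_cast
      field_simp
      linarith
  have h1 := hne α (Or.inl rfl)
  have h2 := hne (-α) (Or.inr rfl)
  rw [neg_mul, sub_neg_eq_add] at h2
  have ha0 : (a : ℝ) ≠ 0 := by exact_mod_cast ha.ne'
  have hint : (a : ℝ) * (((w.1 : ℝ) - α * w.2) * ((w.1 : ℝ) + α * w.2)) =
      ((a * w.1 ^ 2 - b * w.2 ^ 2 : ℤ) : ℝ) := by
    push_cast
    rw [← hab]
    ring
  have hnz : (a : ℝ) * (((w.1 : ℝ) - α * w.2) * ((w.1 : ℝ) + α * w.2)) ≠ 0 :=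
    mul_ne_zero ha0 (mul_ne_zero h1 h2)
  rw [hint] at hnz
  have hZ : (1 : ℤ) ≤ |(a * w.1 ^ 2 - b * w.2 ^ 2 : ℤ)| :=
    Int.one_le_abs (by exact_mod_cast hnz)
  calc (1 : ℝ) ≤ |((a * w.1 ^ 2 - b * w.2 ^ 2 : ℤ) : ℝ)| := by exact_mod_cast hZ
    _ = a * (|(w.1 : ℝ) - α * w.2| * |(w.1 : ℝ) + α * w.2|) := by
      rw [← hint, abs_mul, abs_mul, Nat.abs_cast]

/-- In the triangle `a (u - αv)(u + αv)` is at most `a · δV · (δ + 2α)V`, the square of the quantity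
in `hD`, against the lower bound `1`. -/
lemma notMem_thinTriangle {a b : ℕ} {α δ V : ℝ} (ha : 0 < a) (hab : (a : ℝ) * α ^ 2 = b)
    (hirr : Irrational α) (hα : 0 < α) (hδ : 0 < δ)
    (hD : V * √(δ * a * (δ + 2 * α)) < 1) (w : ℤ × ℤ) : w ∉ thinTriangle α δ V := by
  rintro ⟨h1, h2, h3⟩
  have ha' : (0 : ℝ) < a := by exact_mod_cast ha
  have hv : 0 < (w.2 : ℝ) := pos_of_mul_pos_right (h1.trans_le h2) hδ.le
  have hw : w ≠ 0 := by
    rintro rfl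
    simp at hv
  have hn := one_le_norm_form ha hab hirr hw
  rw [abs_of_pos h1, abs_of_pos (by linarith [mul_pos hα hv])] at hn
  have hV : 0 < V := hv.trans_le h3
  have : (V * √(δ * a * (δ + 2 * α))) ^ 2 < 1 := by
    have : 0 ≤ V * √(δ * a * (δ + 2 * α)) := by positivity
    nlinarith
  rw [mul_pow, Real.sq_sqrt (by positivity)] at this
  have hx : (w.1 : ℝ) - α * w.2 ≤ δ * V := h2.trans (by gcongr)
  have hy : (w.1 : ℝ) + α * w.2 ≤ (δ + 2 * α) * V := by
    have : α * w.2 ≤ α * V := by gcongr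
    linarith
  have : a * (((w.1 : ℝ) - α * w.2) * ((w.1 : ℝ) + α * w.2)) ≤
      a * ((δ * V) * ((δ + 2 * α) * V)) := by
    have := mul_pos hα hv
    gcongr
    linarith
  nlinarith

lemma thinTriangle_count {w₀ : ℤ × ℤ} (hw₀ : IsPrimitive w₀) {m : ℕ} (hm : 0 < m) {a b : ℕ}
    {α δ V : ℝ} (ha : 0 < a) (hab : (a : ℝ) * α ^ 2 = b) (hirr : Irrational α) (hα : 1 ≤ α)
    (hδ : 0 < δ) (hV : 0 < V) :
    {w | w ∈ cyclicLattice w₀ m ∧ w ∈ thinTriangle α δ V}.Finite ∧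
    |({w | w ∈ cyclicLattice w₀ m ∧ w ∈ thinTriangle α δ V}.ncard : ℝ) - δ * V ^ 2 / (2 * m)| ≤
      5 * (V * √(δ * a * (δ + 2 * α))) + 3 := by
  have ha' : (1 : ℝ) ≤ a := by exact_mod_cast ha
  have hm' : (1 : ℝ) ≤ m := by exact_mod_cast hm
  obtain ⟨κ, hκ⟩ : ∃ κ, κ = √(δ * a * (δ + 2 * α)) := ⟨_, rfl⟩
  have hκ2 : κ ^ 2 = δ * a * (δ + 2 * α) := by rw [hκ, Real.sq_sqrt (by positivity)]
  have hκ0 : 0 < κ := by rw [hκ]; positivity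
  obtain ⟨e₁, e₂, he0, hx, hv, hdet, hmem⟩ :=
    -- This `h` balances the bounds for `|u - αv|` and `δ|v|`: both become `√(δm)`.
    exists_basis_cyclicLattice hw₀ hm α (h := √(δ * m)) (by positivity)
  have hsq : √(δ * m) ^ 2 = δ * m := Real.sq_sqrt (by positivity)
  have hs0 : 0 < √(δ * m) := by positivity
  have hδv : |δ * (e₁.2 : ℝ)| ≤ √(δ * m) := by
    rw [abs_mul, abs_of_pos hδ]
    calc δ * |(e₁.2 : ℝ)| ≤ δ * (m / √(δ * m)) := by gcongr
      _ = √(δ * m) ^ 2 / √(δ * m) := by rw [hsq]; ring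
      _ = √(δ * m) := by field_simp
  have hdetR : (e₁.1 : ℝ) * e₂.2 - e₁.2 * e₂.1 = m := by exact_mod_cast hdet
  let φ : ℤ × ℤ → ℤ × ℤ := fun p ↦ p.1 • e₁ + p.2 • e₂
  have hφ1 : ∀ p, (φ p).1 = p.1 * e₁.1 + p.2 * e₂.1 := fun p ↦ rfl
  have hφ2 : ∀ p, (φ p).2 = p.1 * e₁.2 + p.2 * e₂.2 := fun p ↦ rfl
  have hφ : Function.Injective φ := by
    intro p q hpq
    have q1 : p.1 * e₁.1 + p.2 * e₂.1 = q.1 * e₁.1 + q.2 * e₂.1 := congrArg Prod.fst hpq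
    have q2 : p.1 * e₁.2 + p.2 * e₂.2 = q.1 * e₁.2 + q.2 * e₂.2 := congrArg Prod.snd hpq
    have hm0 : (m : ℤ) ≠ 0 := by exact_mod_cast hm.ne'
    refine Prod.ext (mul_left_cancel₀ hm0 ?_) (mul_left_cancel₀ hm0 ?_)
    · rw [← hdet]; linear_combination e₂.2 * q1 - e₂.1 * q2
    · rw [← hdet]; linear_combination e₁.1 * q2 - e₁.2 * q1
  have himg : {w | w ∈ cyclicLattice w₀ m ∧ w ∈ thinTriangle α δ V} =
      φ '' (φ ⁻¹' thinTriangle α δ V) := by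
    ext w
    constructor
    · rintro ⟨h1, h2⟩
      obtain ⟨i, j, rfl⟩ := (hmem w).mp h1
      exact ⟨(i, j), h2, rfl⟩
    · rintro ⟨p, h1, rfl⟩
      exact ⟨(hmem _).mpr ⟨p.1, p.2, rfl⟩, h1⟩
  -- The forms are `u - αv`, `δv - (u - αv)` and `δ(V - v)`, with sum `δV`, in basis coordinates.
  -- The value `lo = δ/κ` comes from the norm form at `e₁`: `|u - αv| ≤ A` and `δ|v| ≤ A` give `1 ≤
  -- a A (A + 2αA/δ) = A² κ²/δ²`. The errors are `3Vκ` from `lo` and at most `2Vκ` from `hi`.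
  have key := triangle_count (W := δ * V) (Δ := δ * m) (lo := δ / κ) (hi := 2 * √(δ * m))
    (A₁ := e₁.1 - α * e₁.2) (A₂ := δ * e₁.2 - (e₁.1 - α * e₁.2)) (A₃ := -(δ * e₁.2))
    (B₁ := e₂.1 - α * e₂.2) (B₂ := δ * e₂.2 - (e₂.1 - α * e₂.2)) (B₃ := -(δ * e₂.2))
    (C₁ := 0) (C₂ := 0) (C₃ := δ * V)
    (by positivity) (by positivity) (by ring) (by ring) (by ring)
    (by linear_combination (-δ) * hdetR) (by positivity) ?_ (by linarith) ?_
    (by rw [abs_neg]; linarith) (S := φ ⁻¹' thinTriangle α δ V) ?_ ?_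
  · rw [himg, Set.ncard_image_of_injective _ hφ]
    refine ⟨key.1.image _, ?_⟩
    rw [← hκ]
    have e1 : (δ * V) ^ 2 / (2 * (δ * m)) = δ * V ^ 2 / (2 * m) := by field_simp
    have e2 : 3 * (δ * V) / (δ / κ) = 3 * (V * κ) := by field_simp
    have e3 : δ * V * (2 * √(δ * m)) / (δ * m) ≤ 2 * (V * κ) := by
      have : √(δ * m) ≤ m * κ := by
        refine Real.sqrt_le_iff.mpr ⟨by positivity, ?_⟩
        rw [mul_pow, hκ2]
        have h1 : 1 ≤ m * a * (δ + 2 * α) := by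
          have : 1 ≤ (m : ℝ) * a := one_le_mul_of_one_le_of_one_le hm' ha'
          exact one_le_mul_of_one_le_of_one_le this (by linarith)
        calc δ * m = δ * m * 1 := by ring
          _ ≤ δ * m * (m * a * (δ + 2 * α)) := by gcongr
          _ = _ := by ring
      rw [div_le_iff₀ (by positivity)]
      calc δ * V * (2 * √(δ * m)) ≤ δ * V * (2 * (m * κ)) := by gcongr
        _ = _ := by ring
    rw [← e1]
    linarith [key.2]
  · intro A h1 _ h3
    rw [abs_neg, abs_mul, abs_of_pos hδ] at h3
    have hA0 : 0 ≤ A := (abs_nonneg _).trans h1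
    have hn := one_le_norm_form ha hab hirr he0
    have hsum : |(e₁.1 : ℝ) + α * e₁.2| ≤ A + 2 * α * (A / δ) := by
      have hq : |(e₁.2 : ℝ)| ≤ A / δ := by rw [le_div_iff₀ hδ]; linarith
      calc |(e₁.1 : ℝ) + α * e₁.2| = |((e₁.1 : ℝ) - α * e₁.2) + 2 * α * e₁.2| := by
            congr 1; ring
        _ ≤ |(e₁.1 : ℝ) - α * e₁.2| + |2 * α * (e₁.2 : ℝ)| := abs_add_le _ _
        _ = |(e₁.1 : ℝ) - α * e₁.2| + 2 * α * |(e₁.2 : ℝ)| := by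
            rw [abs_mul, abs_of_nonneg (by linarith : 0 ≤ 2 * α)]
        _ ≤ _ := by gcongr
    have hle : 1 ≤ a * (A * (A + 2 * α * (A / δ))) := hn.trans (by gcongr)
    rw [div_le_iff₀ hκ0]
    refine le_of_sq_le_sq ?_ (by positivity)
    rw [mul_pow, hκ2]
    calc δ ^ 2 = δ ^ 2 * 1 := by ring
      _ ≤ δ ^ 2 * (a * (A * (A + 2 * α * (A / δ)))) := by gcongr
      _ = A ^ 2 * (δ * a * (δ + 2 * α)) := by field_simp
  · rw [abs_le] at hδv ⊢
    rw [abs_lt] at hx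
    constructor <;> linarith [hδv.1, hδv.2, hx.1, hx.2]
  · rintro p ⟨h1, h2, h3⟩
    rw [hφ1, hφ2] at h1 h2
    rw [hφ2] at h3
    push_cast at h1 h2 h3
    have := mul_le_mul_of_nonneg_left h3 hδ.le
    refine ⟨?_, ?_, ?_⟩ <;> linarith
  · intro i j h1 h2 h3
    refine ⟨?_, ?_, ?_⟩
    · rw [hφ1, hφ2]; push_cast; linarith
    · rw [hφ1, hφ2]; push_cast; linarith
    · rw [hφ2]; push_cast
      refine le_of_mul_le_mul_left ?_ hδ
      linarith

/-! ### Möbius inversion over primitive points -/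

lemma sum_moebius_divisors (g : ℕ) :
    ∑ d ∈ g.divisors, (ArithmeticFunction.moebius d : ℝ) = if g = 1 then 1 else 0 := by
  have h := congrArg (fun f : ArithmeticFunction ℤ ↦ f g) ArithmeticFunction.moebius_mul_coe_zeta
  simp only [ArithmeticFunction.coe_mul_zeta_apply, ArithmeticFunction.one_apply] at h
  exact_mod_cast h

/-- Every divisor of `gcd(u, v)` is at most `v < Q`, so the cutoff loses nothing; `d = 0` divides no
`v > 0`. -/
lemma card_primitive_eq_sum (F : Finset (ℤ × ℤ)) (Q : ℕ) [DecidablePred IsPrimitive]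
    (hF : ∀ w ∈ F, 0 < w.2 ∧ w.2 < Q) :
    ((F.filter IsPrimitive).card : ℝ) = ∑ d ∈ Finset.range Q,
      (ArithmeticFunction.moebius d : ℝ) *
        ((F.filter fun w ↦ (d : ℤ) ∣ w.1 ∧ (d : ℤ) ∣ w.2).card : ℝ) := by
  have hpt : ∀ w ∈ F, (if IsPrimitive w then (1 : ℝ) else 0) = ∑ d ∈ Finset.range Q,
      if (d : ℤ) ∣ w.1 ∧ (d : ℤ) ∣ w.2 then (ArithmeticFunction.moebius d : ℝ) else 0 := by
    intro w hw
    obtain ⟨h1, h2⟩ := hF w hw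
    have hg : 0 < Int.gcd w.1 w.2 := Int.gcd_pos_of_ne_zero_right _ h1.ne'
    rw [← Finset.sum_filter]
    have : (Finset.range Q).filter (fun d : ℕ ↦ (d : ℤ) ∣ w.1 ∧ (d : ℤ) ∣ w.2) =
        (Int.gcd w.1 w.2).divisors := by
      ext d
      rw [Finset.mem_filter, Finset.mem_range, Nat.mem_divisors, ← Int.natCast_dvd_natCast,
        Int.dvd_coe_gcd_iff]
      constructor
      · rintro ⟨-, h⟩
        exact ⟨h, hg.ne'⟩
      · rintro ⟨h, -⟩
        have := Int.le_of_dvd h1 h.2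
        exact ⟨by omega, h⟩
    rw [this, sum_moebius_divisors]
    exact if_congr Iff.rfl rfl rfl
  rw [Finset.card_filter]
  push_cast
  rw [Finset.sum_congr rfl hpt, Finset.sum_comm]
  refine Finset.sum_congr rfl fun d _ ↦ ?_
  rw [← Finset.sum_filter, Finset.sum_const, nsmul_eq_mul, mul_comm]

/-- The points of `Λ` in a thin triangle that are divisible by `d` are the `d`-multiples of the
points of the lattice `{w | d w ∈ Λ}` in the shrunken triangle. -/
lemma ncard_divisible_eq {w₀ : ℤ × ℤ} {n : ℕ} (hn : 0 < n) {α δ V : ℝ} {d : ℕ} (hd : 0 < d) :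
    {w | (w ∈ cyclicLattice w₀ n ∧ w ∈ thinTriangle α δ V) ∧ (d : ℤ) ∣ w.1 ∧ (d : ℤ) ∣ w.2}.ncard =
      {w | w ∈ cyclicLattice w₀ (n / n.gcd d) ∧ w ∈ thinTriangle α δ (V / d)}.ncard := by
  have hd' : (0 : ℝ) < d := by exact_mod_cast hd
  have hinj : Function.Injective fun w : ℤ × ℤ ↦ (d : ℕ) • w := by
    intro x y hxy
    exact nsmul_right_injective hd.ne' hxy
  conv_rhs => rw [← Set.ncard_image_of_injective _ hinj]
  have hL : ∀ w, (d • w ∈ cyclicLattice w₀ n ↔ w ∈ cyclicLattice w₀ (n / n.gcd d)) := fun w ↦ by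
    rw [← comap_nsmul_cyclicLattice hn]; rfl
  have hT : ∀ w : ℤ × ℤ, (d • w ∈ thinTriangle α δ V ↔ w ∈ thinTriangle α δ (V / d)) := by
    intro w
    change (_ ∧ _ ∧ _) ↔ (_ ∧ _ ∧ _)
    rw [Prod.smul_fst, Prod.smul_snd, nsmul_eq_mul, nsmul_eq_mul]
    push_cast
    have e1 : (d : ℝ) * w.1 - α * (d * w.2) = d * (w.1 - α * w.2) := by ring
    have e2 : δ * ((d : ℝ) * w.2) = d * (δ * w.2) := by ring
    rw [e1, e2, mul_pos_iff_of_pos_left hd', mul_le_mul_iff_right₀ hd', le_div_iff₀' hd']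
  congr 1
  ext w
  constructor
  · rintro ⟨⟨h1, h2⟩, ⟨x, hx⟩, ⟨y, hy⟩⟩
    have hw : w = d • ((x, y) : ℤ × ℤ) := by
      refine Prod.ext ?_ ?_
      · rw [Prod.smul_fst, nsmul_eq_mul]; exact hx
      · rw [Prod.smul_snd, nsmul_eq_mul]; exact hy
    rw [hw] at h1 h2
    exact ⟨(x, y), ⟨(hL _).mp h1, (hT _).mp h2⟩, hw.symm⟩
  · rintro ⟨z, ⟨h1, h2⟩, rfl⟩
    refine ⟨⟨(hL z).mpr h1, (hT z).mpr h2⟩, ?_, ?_⟩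
    · simp only [nsmul_eq_mul]; exact dvd_mul_right _ _
    · simp only [nsmul_eq_mul]; exact dvd_mul_right _ _

lemma abs_moebius_mul_le (d : ℕ) {x y : ℝ} (h : |x| ≤ y) :
    |(ArithmeticFunction.moebius d : ℝ) * x| ≤ y := by
  have h1 : |(ArithmeticFunction.moebius d : ℝ)| ≤ 1 := by
    exact_mod_cast ArithmeticFunction.abs_moebius_le_one (n := d)
  rw [abs_mul]
  calc _ ≤ 1 * |x| := by gcongr
    _ ≤ y := by rwa [one_mul]

/-- The number of primitive points of a lattice in a thin triangle with quadratic irrational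
slope. -/
lemma primitive_thinTriangle_count {Λ : AddSubgroup (ℤ × ℤ)} (hΛ : Λ.FiniteIndex)
    (hprim : ∃ p ∈ Λ, IsPrimitive p) {a b : ℕ} {α δ V D : ℝ} (ha : 0 < a)
    (hab : (a : ℝ) * α ^ 2 = b) (hirr : Irrational α) (hα : 1 ≤ α) (hδ : 0 < δ) (hV : 0 < V)
    (hD : D = V * √(δ * a * (δ + 2 * α))) :
    {w | (w ∈ Λ ∧ w ∈ thinTriangle α δ V) ∧ IsPrimitive w}.Finite ∧
    |({w | (w ∈ Λ ∧ w ∈ thinTriangle α δ V) ∧ IsPrimitive w}.ncard : ℝ) -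
      Theta Λ * (δ * V ^ 2 / 2)| ≤ D * (9 + 5 * max 0 (Real.log D)) := by
  classical
  have ha' : (1 : ℝ) ≤ a := by exact_mod_cast ha
  have hD0 : 0 < D := by rw [hD]; positivity
  -- Holds because `a (δ + 2α) ≥ 2`; it bounds the main terms with `d > D`, where there are no
  -- points.
  have hDsq : δ * V ^ 2 ≤ D ^ 2 / 2 := by
    rw [hD, mul_pow, Real.sq_sqrt (by positivity)]
    have h2 : 2 ≤ a * (δ + 2 * α) := by nlinarith
    nlinarith [mul_le_mul_of_nonneg_left h2 (by positivity : 0 ≤ δ * V ^ 2)]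
  obtain ⟨w₀, hw₀, hp₀⟩ := id hprim
  obtain ⟨n, hn⟩ : ∃ n, n = Λ.index := ⟨_, rfl⟩
  have hn0 : 0 < n := hn ▸ Nat.pos_of_ne_zero hΛ.index_ne_zero
  have hΛe : Λ = cyclicLattice w₀ n := hn ▸ eq_cyclicLattice hp₀ hw₀
  have hfin : {w | w ∈ Λ ∧ w ∈ thinTriangle α δ V}.Finite := by
    rw [hΛe]; exact (thinTriangle_count hp₀ hn0 ha hab hirr hα hδ hV).1
  refine ⟨hfin.subset fun w hw ↦ hw.1, ?_⟩
  set F := hfin.toFinset with hF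
  have hmF : ∀ w, w ∈ F ↔ w ∈ Λ ∧ w ∈ thinTriangle α δ V := fun w ↦ hfin.mem_toFinset
  have hcard : ({w | (w ∈ Λ ∧ w ∈ thinTriangle α δ V) ∧ IsPrimitive w}.ncard : ℝ) =
      (F.filter IsPrimitive).card := by
    rw [← Set.ncard_coe_finset]
    congr 2
    ext w
    simp [hmF]
  obtain ⟨N, hN⟩ : ∃ N : ℕ → ℝ, N = fun d : ℕ ↦
    ((F.filter fun w ↦ (d : ℤ) ∣ w.1 ∧ (d : ℤ) ∣ w.2).card : ℝ) := ⟨_, rfl⟩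
  have hNd : ∀ d : ℕ, 0 < d → N d =
      {w | w ∈ cyclicLattice w₀ (n / n.gcd d) ∧ w ∈ thinTriangle α δ (V / d)}.ncard := by
    intro d hd
    rw [← ncard_divisible_eq hn0 hd, hN]
    simp only
    rw [← Set.ncard_coe_finset]
    congr 2
    ext w
    simp [hmF, hΛe]
  have htheta : ∀ d : ℕ, thetaTerm Λ d * (δ * V ^ 2 / 2) = (ArithmeticFunction.moebius d : ℝ) *
      (δ * (V / d) ^ 2 / (2 * (n / n.gcd d : ℕ))) := by
    intro d
    rw [thetaTerm, latticeDet_sublattice hΛ hprim, latticeDet, ← hn]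
    push_cast
    ring
  obtain ⟨k, hk⟩ : ∃ k : ℕ, k = ⌊D⌋₊ := ⟨_, rfl⟩
  have hkD : (k : ℝ) ≤ D := hk ▸ Nat.floor_le hD0.le
  have hkD' : D < k + 1 := hk ▸ Nat.lt_floor_add_one D
  have hmd : ∀ d : ℕ, 0 < n / n.gcd d := fun d ↦
    Nat.div_pos (Nat.gcd_le_left d hn0) (Nat.gcd_pos_of_pos_left d hn0)
  have hE1 : ∀ d : ℕ, 0 < d → |(ArithmeticFunction.moebius d : ℝ) * N d -
      thetaTerm Λ d * (δ * V ^ 2 / 2)| ≤ 5 * D * (d : ℝ)⁻¹ + 3 := by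
    intro d hd
    have hd' : (0 : ℝ) < d := by exact_mod_cast hd
    rw [htheta, ← mul_sub, hNd d hd]
    refine abs_moebius_mul_le d
      ((thinTriangle_count hp₀ (hmd d) ha hab hirr hα hδ (by positivity)).2.trans (le_of_eq ?_))
    rw [hD]
    ring
  have hE2 : ∀ d : ℕ, k < d → |(ArithmeticFunction.moebius d : ℝ) * N d -
      thetaTerm Λ d * (δ * V ^ 2 / 2)| ≤ D ^ 2 / 4 * ((d : ℝ) ^ 2)⁻¹ := by
    intro d hd
    have hd' : (0 : ℝ) < d := by exact_mod_cast (Nat.zero_le k).trans_lt hd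
    have hdD : D < d := hkD'.trans_le (by exact_mod_cast hd)
    have hm1 : (1 : ℝ) ≤ (n / n.gcd d : ℕ) := by exact_mod_cast hmd d
    have hempty : {w | w ∈ cyclicLattice w₀ (n / n.gcd d) ∧
        w ∈ thinTriangle α δ (V / d)} = ∅ := by
      refine Set.eq_empty_of_forall_notMem fun w hw ↦
        notMem_thinTriangle ha hab hirr (by linarith) hδ ?_ w hw.2
      rw [div_mul_eq_mul_div, ← hD, div_lt_one hd']
      exact hdD
    rw [htheta, ← mul_sub, hNd d (by omega), hempty, Set.ncard_empty, Nat.cast_zero, zero_sub]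
    refine abs_moebius_mul_le d ?_
    rw [abs_neg, abs_of_nonneg (by positivity)]
    calc δ * (V / d) ^ 2 / (2 * (n / n.gcd d : ℕ)) ≤ δ * (V / d) ^ 2 / (2 * 1) := by gcongr
      _ = (δ * V ^ 2) / 2 * ((d : ℝ) ^ 2)⁻¹ := by field_simp
      _ ≤ (D ^ 2 / 2) / 2 * ((d : ℝ) ^ 2)⁻¹ := by gcongr
      _ = _ := by ring
  have hpartial : ∀ R : ℕ, k < R → |∑ d ∈ Finset.range R,
      ((ArithmeticFunction.moebius d : ℝ) * N d - thetaTerm Λ d * (δ * V ^ 2 / 2))| ≤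
        D * (9 + 5 * max 0 (Real.log D)) := by
    intro R hR
    have hsplit : Finset.range R = insert 0 (Finset.Icc 1 k ∪ Finset.Ioo k R) := by
      ext d
      simp only [Finset.mem_range, Finset.mem_insert, Finset.mem_union, Finset.mem_Icc,
        Finset.mem_Ioo]
      omega
    have hdisj : Disjoint (Finset.Icc 1 k) (Finset.Ioo k R) := by
      rw [Finset.disjoint_left]
      intro d h1 h2
      rw [Finset.mem_Icc] at h1
      rw [Finset.mem_Ioo] at h2
      omega
    have hharm : ∑ d ∈ Finset.Icc 1 k, (5 * D * (d : ℝ)⁻¹ + 3) ≤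
        5 * D * (1 + max 0 (Real.log D)) + 3 * D := by
      rw [Finset.sum_add_distrib, ← Finset.mul_sum, Finset.sum_const, Nat.card_Icc, nsmul_eq_mul,
        Nat.add_sub_cancel, mul_comm (k : ℝ)]
      have hh : ∑ d ∈ Finset.Icc 1 k, (d : ℝ)⁻¹ ≤ 1 + max 0 (Real.log D) := by
        rcases Nat.eq_zero_or_pos k with h0 | h0
        · rw [h0]
          simp only [Finset.Icc_eq_empty_of_lt zero_lt_one, Finset.sum_empty]
          positivity
        · have h1D : 1 ≤ D := le_trans (by exact_mod_cast h0) hkD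
          have := harmonic_floor_le_one_add_log D h1D
          rw [← hk, harmonic_eq_sum_Icc] at this
          push_cast at this
          exact this.trans (by gcongr; exact le_max_right _ _)
      gcongr
    have htail : ∑ d ∈ Finset.Ioo k R, D ^ 2 / 4 * ((d : ℝ) ^ 2)⁻¹ ≤ D := by
      rw [← Finset.mul_sum]
      calc _ ≤ D ^ 2 / 4 * (2 / (k + 1)) := by gcongr; exact sum_Ioo_inv_sq_le k R
        _ ≤ D ^ 2 / 4 * (2 / D) := by gcongr
        _ = D / 2 := by field_simp; norm_num
        _ ≤ D := by linarith
    rw [hsplit, Finset.sum_insert (by simp), Finset.sum_union hdisj]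
    have hz : (ArithmeticFunction.moebius 0 : ℝ) * N 0 - thetaTerm Λ 0 * (δ * V ^ 2 / 2) = 0 := by
      simp [thetaTerm]
    rw [hz, zero_add]
    refine (abs_add_le _ _).trans ?_
    have s1 := (Finset.abs_sum_le_sum_abs _ (Finset.Icc 1 k)).trans
      (Finset.sum_le_sum fun d hd ↦ hE1 d (Finset.mem_Icc.mp hd).1)
    have s2 := (Finset.abs_sum_le_sum_abs _ (Finset.Ioo k R)).trans
      (Finset.sum_le_sum fun d hd ↦ hE2 d (Finset.mem_Ioo.mp hd).1)
    linarith
  -- The bound for partial sums is uniform in the cutoff `R`, and the Möbius sum for the count is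
  -- exact once `R > V`, so letting `R` grow completes the series for `Θ`.
  have hlim : Filter.Tendsto (fun R : ℕ ↦ |((F.filter IsPrimitive).card : ℝ) -
      (∑ d ∈ Finset.range R, thetaTerm Λ d) * (δ * V ^ 2 / 2)|) Filter.atTop
      (nhds |((F.filter IsPrimitive).card : ℝ) - Theta Λ * (δ * V ^ 2 / 2)|) :=
    (((summable_thetaTerm hΛ hprim).hasSum.tendsto_sum_nat.mul_const _).const_sub _).abs
  rw [hcard]
  refine le_of_tendsto hlim ?_
  filter_upwards [Filter.eventually_gt_atTop k, Filter.eventually_gt_atTop ⌊V⌋₊] with R hR hRV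
  rw [card_primitive_eq_sum F R, Finset.sum_mul, ← Finset.sum_sub_distrib]
  · have := hpartial R hR
    rw [hN] at this
    exact this
  · intro w hw
    obtain ⟨h1, h2, h3⟩ := ((hmF w).mp hw).2
    refine ⟨?_, ?_⟩
    · have : 0 < (w.2 : ℝ) := pos_of_mul_pos_right (h1.trans_le h2) hδ.le
      exact_mod_cast this
    · have : (w.2 : ℝ) < R := h3.trans_lt ((Nat.floor_lt hV.le).mp hRV)
      exact_mod_cast this

/-! ### Specialization of the parameters and the final estimate -/

lemma zoomSet_eq {α r ε K B : ℝ} (hα : 0 ≤ α) (hε : 0 < ε) (hB : 0 < B)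
    (Λ : AddSubgroup (ℤ × ℤ)) :
    zoomSet α r ε K B Λ =
      {w | (w ∈ Λ ∧ w ∈ thinTriangle α (ε * B ^ (-(1 / r))) (K * B)) ∧ IsPrimitive w} := by
  have hδ : 0 < ε * B ^ (-(1 / r)) := by positivity
  ext w
  constructor
  · rintro ⟨h1, h2, -, h4, h5, h6, h7⟩
    have hv : (0 : ℝ) < w.2 := by exact_mod_cast h4
    rw [sub_pos, lt_div_iff₀ hv] at h5
    rw [sub_le_iff_le_add, div_le_iff₀ hv] at h6
    exact ⟨⟨h1, by linarith, by linarith, h7⟩, h2⟩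
  · rintro ⟨⟨h1, h3, h4, h5⟩, h2⟩
    have hv : 0 < (w.2 : ℝ) := pos_of_mul_pos_right (h3.trans_le h4) hδ.le
    have hu : 0 < (w.1 : ℝ) := by linarith [mul_nonneg hα hv.le]
    refine ⟨h1, h2, by exact_mod_cast hu.le, by exact_mod_cast hv, ?_, ?_, h5⟩
    · rw [sub_pos, lt_div_iff₀ hv]; linarith
    · rw [sub_le_iff_le_add, div_le_iff₀ hv]; linarith

/-- The base in `sizeConst` is at least `ε²`, so `sizeConst α ε ≤ ε^(-4/5)`; the remaining power
`ε^(1/5)` is increasing. -/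
lemma mul_sizeConst_le {α ε ε₀ : ℝ} (hα : 1 ≤ α) (hε : 0 < ε) (hε₀ : ε ≤ ε₀) :
    ε * sizeConst α ε ≤ ε₀ ^ (1 / 5 : ℝ) := by
  have h1 : sizeConst α ε ≤ (ε ^ (2 : ℝ)) ^ (-(2 / 5) : ℝ) := by
    refine Real.rpow_le_rpow_of_nonpos (by positivity) ?_ (by norm_num)
    rw [Real.rpow_two]
    have : 1 ≤ α ^ 2 := one_le_pow₀ hα
    nlinarith [mul_le_mul_of_nonneg_right this (sq_nonneg ε), sq_nonneg ε]
  calc ε * sizeConst α ε ≤ ε * (ε ^ (2 : ℝ)) ^ (-(2 / 5) : ℝ) := by gcongr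
    _ = ε ^ (1 : ℝ) * ε ^ (2 * -(2 / 5) : ℝ) := by rw [← Real.rpow_mul hε.le, Real.rpow_one]
    _ = ε ^ (1 / 5 : ℝ) := by rw [← Real.rpow_add hε]; norm_num
    _ ≤ ε₀ ^ (1 / 5 : ℝ) := by gcongr

end ZoomLattice

theorem mainTheorem6 :
    (∀ Λ : AddSubgroup (ℤ × ℤ), Λ.FiniteIndex → (∃ p ∈ Λ, ZoomLattice.IsPrimitive p) →
      Summable (ZoomLattice.thetaTerm Λ) ∧
      ZoomLattice.Theta Λ =
        6 / Real.pi ^ 2 * ZoomLattice.Psi1 (ZoomLattice.latticeDet Λ) /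
          (ZoomLattice.latticeDet Λ : ℝ)) ∧
    (∀ ε₀ α₀ : ℝ, ∃ C : ℝ, 0 < C ∧
      ∀ (r ε K B α : ℝ) (a b : ℕ) (Λ : AddSubgroup (ℤ × ℤ)),
        1 / 2 < r → r < 7 / 10 →
        0 < ε → ε ≤ ε₀ → 0 < K → 2 ≤ B →
        0 < a → a < b → α = Real.sqrt ((b : ℝ) / (a : ℝ)) → Irrational α → α ≤ α₀ →
        Λ.FiniteIndex → (∃ p ∈ Λ, ZoomLattice.IsPrimitive p) →
        K ^ 2 * (b : ℝ) ≤
          ZoomLattice.sizeConst α ε * B ^ (4 / 5 * (1 / r - 1) - 3 / 5 * (2 - 1 / r)) →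
        (b : ℝ) * (ZoomLattice.latticeDet Λ : ℝ) ^ 2 ≤ K ^ 2 * B ^ (2 - 1 / r) →
        (ZoomLattice.zoomSet α r ε K B Λ).Finite ∧
        |((ZoomLattice.zoomSet α r ε K B Λ).ncard : ℝ) -
            ZoomLattice.Theta Λ * ε * K ^ 2 / 2 * B ^ (2 - 1 / r)| ≤
          C * (K ^ (3 / 2 : ℝ) * (b : ℝ) ^ (1 / 4 : ℝ) *
                (ZoomLattice.latticeDet Λ : ℝ) ^ (1 / 2 : ℝ) *
                B ^ (3 / 4 * (2 - 1 / r)) * Real.log B +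
              K * (b : ℝ) ^ (3 / 2 : ℝ) * B ^ (1 - 1 / (2 * r)) * Real.log B)) := by
  refine ⟨fun Λ hΛ h ↦ ⟨ZoomLattice.summable_thetaTerm hΛ h, ZoomLattice.Theta_eq hΛ h⟩,
    fun ε₀ α₀ ↦ ?_⟩
  obtain ⟨c₁, hc₁⟩ : ∃ c₁ : ℝ, c₁ = max 1 ((ε₀ + 2 * α₀) * ε₀ ^ (1 / 5 : ℝ)) := ⟨_, rfl⟩
  obtain ⟨c₂, hc₂⟩ : ∃ c₂ : ℝ, c₂ = √((ε₀ + 2 * α₀) * ε₀) := ⟨_, rfl⟩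
  obtain ⟨c₃, hc₃⟩ : ∃ c₃ : ℝ, c₃ = 9 / Real.log 2 + 5 * (1 + Real.log c₁ / Real.log 2) := ⟨_, rfl⟩
  have hc₁1 : 1 ≤ c₁ := hc₁ ▸ le_max_left _ _
  have hlc₁ : 0 ≤ Real.log c₁ := Real.log_nonneg hc₁1
  have hl2 : 0 < Real.log 2 := Real.log_pos (by norm_num)
  have hc₃0 : 0 < c₃ := by rw [hc₃]; positivity
  have hc₂0 : 0 ≤ c₂ := hc₂ ▸ Real.sqrt_nonneg _
  refine ⟨c₂ * c₃ + 1, by positivity, ?_⟩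
  intro r ε K B α a b Λ hr _ hε hεε₀ hK hB ha hab hαe hirr hαα₀ hΛ hprim hsize _
  have hB0 : 0 < B := by linarith
  have hB1 : 1 ≤ B := by linarith
  have hr0 : 0 < r := by linarith
  have hε₀0 : 0 ≤ ε₀ := hε.le.trans hεε₀
  have ha' : (1 : ℝ) ≤ a := by exact_mod_cast ha
  have hab' : (a : ℝ) ≤ b := by exact_mod_cast hab.le
  have hb1 : (1 : ℝ) ≤ b := ha'.trans hab'
  have hα1 : 1 ≤ α := by
    rw [hαe, Real.one_le_sqrt, one_le_div (by linarith)]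
    exact hab'
  have hαsq : (a : ℝ) * α ^ 2 = b := by
    rw [hαe, Real.sq_sqrt (by positivity)]
    field_simp
  obtain ⟨δ, hδ⟩ : ∃ δ, δ = ε * B ^ (-(1 / r)) := ⟨_, rfl⟩
  obtain ⟨D, hD⟩ : ∃ D, D = K * B * √(δ * a * (δ + 2 * α)) := ⟨_, rfl⟩
  have hδ0 : 0 < δ := by rw [hδ]; positivity
  have hδε : δ ≤ ε := by
    rw [hδ]
    refine mul_le_of_le_one_right hε.le (Real.rpow_le_one_of_one_le_of_nonpos hB1 ?_)
    rw [neg_nonpos]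
    positivity
  have hD0 : 0 < D := by rw [hD]; positivity
  obtain ⟨hfin, hcount⟩ := ZoomLattice.primitive_thinTriangle_count hΛ hprim ha hαsq hirr hα1 hδ0
    (mul_pos hK hB0) hD
  rw [hδ] at hfin hcount
  rw [ZoomLattice.zoomSet_eq (by linarith) hε hB0]
  refine ⟨hfin, ?_⟩
  have hpow : B ^ (-(1 / r)) * B ^ 2 = B ^ (2 - 1 / r) := by
    rw [← Real.rpow_two, ← Real.rpow_add hB0]
    congr 1
    ring
  have hmain : ZoomLattice.Theta Λ * (ε * B ^ (-(1 / r)) * (K * B) ^ 2 / 2) =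
      ZoomLattice.Theta Λ * ε * K ^ 2 / 2 * B ^ (2 - 1 / r) := by
    rw [← hpow]; ring
  rw [hmain] at hcount
  refine hcount.trans ?_
  obtain ⟨T, hT⟩ : ∃ T, T = B ^ (2 - 1 / r) := ⟨_, rfl⟩
  have hT0 : 0 < T := by rw [hT]; positivity
  have hc₀ : 0 < ε₀ + 2 * α₀ := by linarith
  have hDsq : D ^ 2 ≤ (ε₀ + 2 * α₀) * (ε * (K ^ 2 * b * T)) := by
    rw [hD, mul_pow, Real.sq_sqrt (by positivity), mul_pow]
    calc K ^ 2 * B ^ 2 * (δ * a * (δ + 2 * α))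
        ≤ K ^ 2 * B ^ 2 * (δ * b * (ε₀ + 2 * α₀)) := by gcongr; linarith
      _ = (ε₀ + 2 * α₀) * (ε * (K ^ 2 * b * (B ^ (-(1 / r)) * B ^ 2))) := by rw [hδ]; ring
      _ = _ := by rw [hpow, hT]
  have hDT : D ≤ c₂ * (K * (b : ℝ) ^ (3 / 2 : ℝ) * B ^ (1 - 1 / (2 * r))) := by
    have hB2 : (B ^ (1 - 1 / (2 * r))) ^ 2 = T := by
      rw [hT, ← Real.rpow_natCast, ← Real.rpow_mul hB0.le]
      congr 1
      push_cast
      field_simp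
    have hb2 : (b : ℝ) ≤ ((b : ℝ) ^ (3 / 2 : ℝ)) ^ 2 := by
      rw [← Real.rpow_natCast, ← Real.rpow_mul (by linarith)]
      exact Real.self_le_rpow_of_one_le hb1 (by norm_num)
    refine le_of_sq_le_sq ?_ (by positivity)
    rw [mul_pow, mul_pow, mul_pow, hB2, hc₂,
      Real.sq_sqrt (mul_nonneg hc₀.le hε₀0)]
    calc D ^ 2 ≤ (ε₀ + 2 * α₀) * (ε * (K ^ 2 * b * T)) := hDsq
      _ ≤ (ε₀ + 2 * α₀) * (ε₀ * (K ^ 2 * ((b : ℝ) ^ (3 / 2 : ℝ)) ^ 2 * T)) := by gcongr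
      _ = _ := by ring
  have hDB : D ^ 2 ≤ c₁ * B := by
    -- The exponents of `B` add up to `2/(5r)`, which is below `1` because `r > 1/2`.
    have hsz : ε * (K ^ 2 * b * T) ≤ ε₀ ^ (1 / 5 : ℝ) * B := by
      calc ε * (K ^ 2 * b * T) ≤ ε * ((ZoomLattice.sizeConst α ε *
            B ^ (4 / 5 * (1 / r - 1) - 3 / 5 * (2 - 1 / r))) * T) := by gcongr
        _ = (ε * ZoomLattice.sizeConst α ε) *
            (B ^ (4 / 5 * (1 / r - 1) - 3 / 5 * (2 - 1 / r)) * B ^ (2 - 1 / r)) := by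
            rw [hT]; ring
        _ ≤ ε₀ ^ (1 / 5 : ℝ) * B ^ (1 : ℝ) := by
            rw [← Real.rpow_add hB0]
            have h2 : 1 / r ≤ 2 := by
              rw [div_le_iff₀ hr0]; linarith
            gcongr
            · exact ZoomLattice.mul_sizeConst_le hα1 hε hεε₀
            · linarith
        _ = _ := by rw [Real.rpow_one]
    calc D ^ 2 ≤ (ε₀ + 2 * α₀) * (ε₀ ^ (1 / 5 : ℝ) * B) := hDsq.trans (by gcongr)
      _ = ((ε₀ + 2 * α₀) * ε₀ ^ (1 / 5 : ℝ)) * B := by ring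
      _ ≤ c₁ * B := by gcongr; rw [hc₁]; exact le_max_right _ _
  have hlB : Real.log 2 ≤ Real.log B := Real.log_le_log (by norm_num) hB
  have hlB0 : 0 < Real.log B := hl2.trans_le hlB
  have hlog : max 0 (Real.log D) ≤ Real.log c₁ + Real.log B := by
    refine max_le (by positivity) ?_
    have := Real.log_le_log (by positivity) hDB
    rw [Real.log_pow, Real.log_mul (by positivity) (by positivity)] at this
    push_cast at this
    linarith
  -- Constants are absorbed into `log B` through `log B ≥ log 2`.
  have hfac : 9 + 5 * max 0 (Real.log D) ≤ c₃ * Real.log B := by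
    have h1 : 1 ≤ Real.log B / Real.log 2 := by rwa [one_le_div hl2]
    calc 9 + 5 * max 0 (Real.log D) ≤ 9 * 1 + 5 * (Real.log c₁ * 1 + Real.log B) := by
          linarith
      _ ≤ 9 * (Real.log B / Real.log 2) +
          5 * (Real.log c₁ * (Real.log B / Real.log 2) + Real.log B) := by gcongr
      _ = c₃ * Real.log B := by rw [hc₃]; ring
  have hE1 : 0 ≤ K ^ (3 / 2 : ℝ) * (b : ℝ) ^ (1 / 4 : ℝ) *
      (ZoomLattice.latticeDet Λ : ℝ) ^ (1 / 2 : ℝ) * B ^ (3 / 4 * (2 - 1 / r)) * Real.log B := by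
    positivity
  have hE2 : 0 ≤ K * (b : ℝ) ^ (3 / 2 : ℝ) * B ^ (1 - 1 / (2 * r)) * Real.log B := by positivity
  calc D * (9 + 5 * max 0 (Real.log D))
      ≤ (c₂ * (K * (b : ℝ) ^ (3 / 2 : ℝ) * B ^ (1 - 1 / (2 * r)))) * (c₃ * Real.log B) := by
        gcongr
    _ = c₂ * c₃ * (K * (b : ℝ) ^ (3 / 2 : ℝ) * B ^ (1 - 1 / (2 * r)) * Real.log B) := by ring
    _ ≤ (c₂ * c₃ + 1) * (K ^ (3 / 2 : ℝ) * (b : ℝ) ^ (1 / 4 : ℝ) *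
          (ZoomLattice.latticeDet Λ : ℝ) ^ (1 / 2 : ℝ) * B ^ (3 / 4 * (2 - 1 / r)) * Real.log B +
          K * (b : ℝ) ^ (3 / 2 : ℝ) * B ^ (1 - 1 / (2 * r)) * Real.log B) := by
        gcongr
        · linarith
        · linarith
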